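/- Let $d\ge 2$, $\gamma\in(-d,0)$, $\nu\in(0,2)$, $0<c_0\le c_1$, and let $b$ be a measurable function on $[-1,1]$ with $$c_0\,\theta^{-(d-1)-\nu}\le b(\cos\theta)\le c_1\,\theta^{-(d-1)-\nu}\qquad\text{for all }\theta\in(0,\pi].$$ Put $B(v-v_*,\sigma)=|v-v_*|^\gamma b(\cos\theta)$ with $\cos\theta=\frac{v-v_*}{|v-v_*|}\cdot\sigma$ and $v'=\frac{v+v_*}2+\frac{|v-v_*|}2\sigma$ for $v,v_*\in\mathbb R^d$, $\sigma\in\mathbb S^{d-1}$. Let $\mathcal M(v)=(2\pi)^{-d/2}e^{-|v|^2/2}$ and $\langle v\rangle=\sqrt{1+|v|^2}$. For $f\in L^1(\mathbb R^d)$ (real valued) put $\varrho_f=\int_{\mathbb R^d} f\,dv$, $h=f/\mathcal M$ and $$\mathbb D(f)=\frac12\int_{\mathbb R^d\times\mathbb R^d\times\mathbb S^{d-1}}B(v-v_*,\sigma)\,\mathcal M(v)\mathcal M(v_*)\,\bigl(h(v)-h(v')\bigr)^2\,dv\,dv_*\,d\sigma\in[0,\infty].$$ The weighted norms are $\|g\|^2_{L^2(\langle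 v\rangle^{s}\mathcal M^{-1})}=\int_{\mathbb R^d} g^2\langle v\rangle^s\mathcal M^{-1}\,dv\in[0,\infty]$. Then: 1. For every $\varepsilon>0$ there is a constant $C=C(B,\varepsilon)>0$ such that for all $f\in L^1(\mathbb R^d)$ $$\mathbb D(f)\ \ge\ C\,\|f-\varrho_f\mathcal M\|^2_{L^2(\langle v\rangle^{\gamma+\nu-\varepsilon}\mathcal M^{-1})}.$$ 2. If $\gamma+\nu>0$, there is $\lambda>0$, depending only on $B$, such that for all $f\in L^1(\mathbb R^d)$ $$\mathbb D(f)\ \ge\ \lambda\,\|f-\varrho_f\mathcal M\|^2_{L^2(\mathcal M^{-1})},$$ and the linear Boltzmann operator $\boldsymbol L_B$ has a spectral gap of size $\lambda$ in $L^2(\mathcal M^{-1})$: $0$ is a simple eigenvalue with eigenfunction $\mathcal M$, and the rest of the spectrum is contained in $(-\infty,-\lambda]$. Here $\boldsymbol L_B$ is the operator associated with the Dirichlet form, i.e. $\boldsymbol L_Bf=g$ means that $f,g\in L^2(\mathcal M^{-1})$, $\mathbb D(f)<\infty$ and $\langle g,\varphi\rangle_{L^2(\mathcal M^{-1})}=-\mathbb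 D(f,\varphi)$ for all $\varphi\in L^2(\mathcal M^{-1})$ with $\mathbb D(\varphi)<\infty$, where $\mathbb D(\cdot,\cdot)$ is the symmetric bilinear form with quadratic form $\mathbb D$. -/

import Mathlib

open MeasureTheory Set

namespace LinBoltz

noncomputable section

/-- The velocity space `ℝ^d` with its Euclidean norm. -/
abbrev Vel (d : ℕ) : Type := EuclideanSpace ℝ (Fin d)

/-- The unit sphere `S^{d-1}`. -/
abbrev Sph (d : ℕ) : Type := Metric.sphere (0 : Vel d) 1

/-- The normalised Maxwellian `M(v) = (2π)^{-d/2} exp (-|v|²/2)`. -/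
def maxwellian {d : ℕ} (v : Vel d) : ℝ :=
  1 / (2 * Real.pi) ^ ((d : ℝ) / 2) * Real.exp (-‖v‖ ^ 2 / 2)

/-- The bracket `⟨v⟩ = √(1 + |v|²)`. -/
def bracket {d : ℕ} (v : Vel d) : ℝ := Real.sqrt (1 + ‖v‖ ^ 2)

/-- The mass `ϱ_f = ∫ f dv`. -/
def mass {d : ℕ} (f : Vel d → ℝ) : ℝ := ∫ v, f v

/-- The velocity `v' = (v + v_*)/2 + |v - v_*| σ / 2`. -/
def vPrime {d : ℕ} (v vs : Vel d) (σ : Sph d) : Vel d :=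
  (1 / 2 : ℝ) • (v + vs) + (‖v - vs‖ / 2) • (σ : Vel d)

/-- `cos θ = (v - v_*)/|v - v_*| · σ` (the diagonal `v = v_*` is a null set). -/
def cosTheta {d : ℕ} (v vs : Vel d) (σ : Sph d) : ℝ :=
  inner ℝ (v - vs) (σ : Vel d) / ‖v - vs‖

/-- The collision kernel `B(v - v_*, σ) = |v - v_*|^γ b(cos θ)`. -/
def kernelB {d : ℕ} (γ : ℝ) (b : ℝ → ℝ) (v vs : Vel d) (σ : Sph d) : ℝ :=
  ‖v - vs‖ ^ γ * b (cosTheta v vs σ)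

/-- The surface measure `dσ` of the unit sphere. -/
def surfaceMeasure (d : ℕ) : Measure (Sph d) := (volume : Measure (Vel d)).toSphere

instance (d : ℕ) : IsFiniteMeasure (surfaceMeasure d) := by
  unfold surfaceMeasure; infer_instance

/-- The measure `dv dv_* dσ`. -/
def collMeasure (d : ℕ) : Measure (Vel d × Vel d × Sph d) :=
  (volume : Measure (Vel d)).prod ((volume : Measure (Vel d)).prod (surfaceMeasure d))

instance (d : ℕ) : SFinite (collMeasure d) := by
  have h : SFinite ((volume : Measure (Vel d)).prod (surfaceMeasure d)) := inferInstance
  unfold collMeasure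
  infer_instance

/-- The collisional increment `h(v) - h(v')` of `h = f / M`. -/
def increment {d : ℕ} (f : Vel d → ℝ) (p : Vel d × Vel d × Sph d) : ℝ :=
  f p.1 / maxwellian p.1
    - f (vPrime p.1 p.2.1 p.2.2) / maxwellian (vPrime p.1 p.2.1 p.2.2)

/-- The weight `B(v - v_*, σ) M(v) M(v_*)`. -/
def collWeight {d : ℕ} (γ : ℝ) (b : ℝ → ℝ) (p : Vel d × Vel d × Sph d) : ℝ :=
  kernelB γ b p.1 p.2.1 p.2.2 * maxwellian p.1 * maxwellian p.2.1

/-- The Dirichlet form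
`𝔻(f) = 1/2 ∫ b(cos θ) |v - v_*|^γ M(v) M(v_*) (h(v) - h(v'))² dv dv_* dσ`, `h = f / M`,
with values in `[0, ∞]`. -/
def dirichlet {d : ℕ} (γ : ℝ) (b : ℝ → ℝ) (f : Vel d → ℝ) : ENNReal :=
  (1 / 2 : ENNReal) *
    ∫⁻ p, ENNReal.ofReal (collWeight γ b p * increment f p ^ 2) ∂(collMeasure d)

/-- The squared norm `‖g‖²` of `L²(⟨v⟩^s M⁻¹)`, with values in `[0, ∞]`. -/
def sqNorm {d : ℕ} (s : ℝ) (g : Vel d → ℝ) : ENNReal :=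
  ∫⁻ v, ENNReal.ofReal (g v ^ 2 * bracket v ^ s / maxwellian v)

/-- Membership in the Hilbert space `L²(M⁻¹)`. -/
def MemL2 {d : ℕ} (f : Vel d → ℝ) : Prop :=
  AEStronglyMeasurable f volume ∧ sqNorm 0 f < ⊤

/-- The inner product of `L²(M⁻¹)`. -/
def innerL2 {d : ℕ} (f g : Vel d → ℝ) : ℝ := ∫ v, f v * g v / maxwellian v

/-- The form domain: the functions of `L²(M⁻¹)` with finite Dirichlet form. -/
def MemForm {d : ℕ} (γ : ℝ) (b : ℝ → ℝ) (f : Vel d → ℝ) : Prop :=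
  MemL2 f ∧ dirichlet γ b f < ⊤

/-- The symmetric bilinear form whose quadratic form is the Dirichlet form (the integrand is
absolutely integrable for `f` and `φ` in the form domain). -/
def dirichletBilin {d : ℕ} (γ : ℝ) (b : ℝ → ℝ) (f φ : Vel d → ℝ) : ℝ :=
  (1 / 2) * ∫ p, collWeight γ b p * increment f p * increment φ p ∂(collMeasure d)

/-- `f` belongs to the domain of the linear Boltzmann operator `L_B` in `L²(M⁻¹)` and `L_B f = g`.
For a kernel without angular cut-off the collision integral `∫ B (f' M_*' - f M_*) dv_* dσ` need
not converge absolutely, and `L_B` is understood in the weak sense, as the self-adjoint operator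
associated with the Dirichlet form: `⟨L_B f, φ⟩ = -𝔻(f, φ)` for all `φ` in the form domain. -/
def IsImage {d : ℕ} (γ : ℝ) (b : ℝ → ℝ) (f g : Vel d → ℝ) : Prop :=
  MemForm γ b f ∧ MemL2 g ∧
    ∀ φ : Vel d → ℝ, MemForm γ b φ → innerL2 g φ = -dirichletBilin γ b f φ

/-- `κ` belongs to the resolvent set of `L_B` in `L²(M⁻¹)`: the operator `L_B - κ` maps its domain
onto `L²(M⁻¹)`, and it is injective with bounded inverse. Only real `κ` are needed, since `L_B` is
self-adjoint. -/
def InResolventSet {d : ℕ} (γ : ℝ) (b : ℝ → ℝ) (κ : ℝ) : Prop :=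
  (∀ g : Vel d → ℝ, MemL2 g → ∃ f : Vel d → ℝ, IsImage γ b f (fun v => g v + κ * f v)) ∧
    ∃ K : NNReal, ∀ f g : Vel d → ℝ, MemL2 g → IsImage γ b f (fun v => g v + κ * f v) →
      sqNorm 0 f ≤ (K : ENNReal) * sqNorm 0 g

/-- `L_B` has a spectral gap of size `lam` in `L²(M⁻¹)`: `0` is a simple eigenvalue with
eigenfunction `M`, and the rest of the spectrum is contained in `(-∞, -lam]`. -/
def HasSpectralGap (d : ℕ) (γ : ℝ) (b : ℝ → ℝ) (lam : ℝ) : Prop :=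
  (∀ f : Vel d → ℝ, IsImage γ b f (fun _ => 0) ↔
      ∃ c : ℝ, f =ᵐ[volume] fun v => c * maxwellian v) ∧
    ∀ κ : ℝ, -lam < κ → κ ≠ 0 → InResolventSet (d := d) γ b κ

end

end LinBoltz

/-! Write `h = f / M` and `s = γ + ν`. Both claims follow from one inequality, coercivity of `𝔻` in
the norm of weight `⟨v⟩^s`, obtained here without any loss `ε`. Its proof patches an estimate at
large velocities with a Poincaré inequality on a ball.

Large velocities. Fix `a` and keep only the collisions with `|v' - v|` of order `a`. If `ρ = |v -
v_*|` is large, these fill a spherical annulus of opening `a / ρ`. There the angular singularity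
makes `B` at least a constant times `ρ^s (ρ / a)^(d-1)`, so the retained cross section is comparable
to `ρ^s`, hence to `⟨v⟩^s` for bounded `v_*` (`subKernel_le`, `exists_lintegral_subKernel`). The
function `exp (|v|² / 4)` serves as a Lyapunov function: `2 h h' ≤ h² e^t + h'² e^(-t)` with `t =
(|v'|² - |v|²) / 4`, combined with the symmetry between `v` and `v'`, bounds the loss term by the
Dirichlet form plus a gain term carrying the factor `e^t` (`two_mul_lintegral_le`). Since `|v'|² -
|v|² = 2 v_* · (v' - v) - |v' - v|²`, this factor is at most `exp (3|v_*|² / 8 - a² / 24)`. The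
Maxwellian absorbs the first term, and a large `a` makes the gain smaller than half of the loss.
What remains is the integral over a ball (`exists_lyapunov_bound`).

Bounded velocities. For fixed `σ` the map from `v - v_*` to `v' - v` is explicit, invertible on its
range and 1-Lipschitz. It therefore does not increase volumes, so a single collision connects any
two points of a ball with a density bounded below (`exists_lintegral_ball_le`). This controls the
double integral of `(h(v') - h(v))²` over the ball (`exists_local_poincare`).

The constant produced by the local inequality is exchanged for the mass by a weighted Cauchy–Schwarz
inequality (`exists_sqNorm_sub_mass_le`).

Spectral gap. If `s > 0` then `⟨v⟩^s ≥ 1`, which gives a Poincaré inequality in `L²(M⁻¹)`. The form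
is closed because almost everywhere convergence passes to increments, the map to `v'` being
non-singular. The resolvent equation is solved by Lax–Milgram after adding a rank one term along `M`
(`exists_resolvent_solution`). -/

namespace LinBoltz

open scoped Pointwise

/-! ### Surface of spherical caps and annuli -/

/-- A unit vector is the first vector of an orthonormal basis. -/
theorem exists_orthonormalBasis_zero_eq {n : ℕ} {ω : Vel (n + 2)} (hω : ‖ω‖ = 1) :
    ∃ B : OrthonormalBasis (Fin (n + 2)) ℝ (Vel (n + 2)), B 0 = ω := by
  have h : Orthonormal ℝ (({0} : Set (Fin (n + 2))).domRestrict fun _ => ω) := by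
    refine ⟨fun _ => hω, ?_⟩
    intro i j hij
    exact absurd (Subsingleton.elim i j) hij
  obtain ⟨B, hB⟩ := h.exists_orthonormalBasis_extension_of_card_eq (by simp)
  exact ⟨B, hB 0 (by simp)⟩

/-- The volume of a box in the coordinates of an orthonormal basis. -/
theorem volume_box {d : ℕ} (B : OrthonormalBasis (Fin d) ℝ (Vel d)) (l u : Fin d → ℝ) :
    volume {x : Vel d | ∀ i, B.repr x i ∈ Icc (l i) (u i)} = ∏ i, ENNReal.ofReal (u i - l i) := by
  rw [← Real.volume_Icc_pi]
  have h := (PiLp.volume_preserving_ofLp (Fin d)).comp B.measurePreserving_repr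
  rw [← h.measure_preimage measurableSet_Icc.nullMeasurableSet]
  congr 1
  ext x
  simp [Set.mem_Icc, Pi.le_def, forall_and]

theorem norm_sq_eq_sum_repr {n : ℕ} (B : OrthonormalBasis (Fin (n + 2)) ℝ (Vel (n + 2)))
    (x : Vel (n + 2)) :
    ‖x‖ ^ 2 = B.repr x 0 ^ 2 + ∑ i : Fin (n + 1), B.repr x i.succ ^ 2 := by
  rw [← B.repr.norm_map x, EuclideanSpace.norm_sq_eq, Fin.sum_univ_succ]
  simp

theorem measurableSet_cap {d : ℕ} (ω : Vel d) (a b : ℝ) :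
    MeasurableSet {σ : Sph d | a ≤ 1 - inner ℝ ω (σ : Vel d) ∧ 1 - inner ℝ ω (σ : Vel d) ≤ b} := by
  refine (IsClosed.inter (s₁ := {σ : Sph d | a ≤ 1 - inner ℝ ω (σ : Vel d)})
    (s₂ := {σ : Sph d | 1 - inner ℝ ω (σ : Vel d) ≤ b}) ?_ ?_).measurableSet
  · exact isClosed_le (by fun_prop) (by fun_prop)
  · exact isClosed_le (by fun_prop) (by fun_prop)

theorem surfaceMeasure_apply {d : ℕ} {s : Set (Sph d)} (hs : MeasurableSet s) :
    surfaceMeasure d s = d * volume (Ioo (0 : ℝ) 1 • ((↑) '' s : Set (Vel d))) := by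
  rw [surfaceMeasure, Measure.toSphere_apply' _ hs]
  simp

/-- A spherical cap of opening `r` has surface at most `C r^(d-1)`. -/
theorem exists_cap_le {d : ℕ} (hd : 2 ≤ d) : ∃ C : ℝ, 0 < C ∧ ∀ ω : Vel d, ‖ω‖ = 1 →
    ∀ (a r : ℝ), 0 ≤ r →
      surfaceMeasure d {σ : Sph d | a ≤ 1 - inner ℝ ω (σ : Vel d) ∧
        1 - inner ℝ ω (σ : Vel d) ≤ r ^ 2} ≤ ENNReal.ofReal (C * r ^ (d - 1)) := by
  obtain ⟨n, rfl⟩ : ∃ n, d = n + 2 := ⟨d - 2, by omega⟩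
  refine ⟨(n + 2) * (2 * 4 ^ (n + 1)), by positivity, fun ω hω a r hr => ?_⟩
  obtain ⟨B, hB⟩ := exists_orthonormalBasis_zero_eq hω
  rw [surfaceMeasure_apply (measurableSet_cap ω _ _)]
  -- The surface of the cap is `d` times the volume of the cone over it. With `c = ω · σ`, the
  -- transverse part of `σ` has square `1 - c² ≤ 2 (1 - c) ≤ 2 r²`, so the cone fits in a box of
  -- half-width `2 r` across `ω`.
  have hsub : (Ioo (0 : ℝ) 1 • ((↑) '' {σ : Sph (n + 2) | a ≤ 1 - inner ℝ ω (σ : Vel (n + 2)) ∧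
        1 - inner ℝ ω (σ : Vel (n + 2)) ≤ r ^ 2} : Set (Vel (n + 2)))) ⊆
      {x | ∀ i, B.repr x i ∈ Icc ((Fin.cons (-1) fun _ => -(2 * r) : Fin (n + 2) → ℝ) i)
        ((Fin.cons 1 fun _ => 2 * r : Fin (n + 2) → ℝ) i)} := by
    rintro _ ⟨t, ⟨ht0, ht1⟩, _, ⟨σ, ⟨-, hσ⟩, rfl⟩, rfl⟩
    have hn : ‖(σ : Vel (n + 2))‖ = 1 := by simp
    have hx := norm_sq_eq_sum_repr B (σ : Vel (n + 2))
    have h0 : B.repr (σ : Vel (n + 2)) 0 = inner ℝ ω (σ : Vel (n + 2)) := by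
      rw [B.repr_apply_apply, hB]
    rw [hn, h0] at hx
    set c := inner ℝ ω (σ : Vel (n + 2)) with hc
    have hs0 : ∀ i : Fin (n + 1), B.repr (σ : Vel (n + 2)) i.succ ^ 2 ≤
        ∑ i : Fin (n + 1), B.repr (σ : Vel (n + 2)) i.succ ^ 2 := fun i =>
      Finset.single_le_sum (f := fun i : Fin (n + 1) => B.repr (σ : Vel (n + 2)) i.succ ^ 2)
        (fun _ _ => sq_nonneg _) (Finset.mem_univ i)
    have hsum : 0 ≤ ∑ i : Fin (n + 1), B.repr (σ : Vel (n + 2)) i.succ ^ 2 :=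
      Finset.sum_nonneg fun _ _ => sq_nonneg _
    have hc1 : |c| ≤ 1 := abs_le_one_iff_mul_self_le_one.2 (by nlinarith)
    have hc2 := abs_le.1 hc1
    intro i
    refine Fin.cases ?_ (fun j => ?_) i
    · simp only [map_smul, PiLp.smul_apply, smul_eq_mul, h0, Fin.cons_zero, mem_Icc]
      rw [← abs_le, abs_mul, abs_of_pos ht0]
      exact mul_le_one₀ ht1.le (abs_nonneg _) hc1
    · simp only [map_smul, PiLp.smul_apply, smul_eq_mul, Fin.cons_succ, mem_Icc]
      have h1 : B.repr (σ : Vel (n + 2)) j.succ ^ 2 ≤ (2 * r) ^ 2 := by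
        nlinarith [hs0 j]
      have h2 : |B.repr (σ : Vel (n + 2)) j.succ| ≤ 2 * r := abs_le_of_sq_le_sq h1 (by positivity)
      rw [← abs_le, abs_mul, abs_of_pos ht0]
      calc _ ≤ 1 * |B.repr (σ : Vel (n + 2)) j.succ| := by gcongr
        _ ≤ _ := by simpa using h2
  have hvol := (measure_mono hsub).trans_eq (volume_box B _ _)
  rw [Fin.prod_univ_succ] at hvol
  simp only [Fin.cons_zero, Fin.cons_succ, Finset.prod_const, Finset.card_univ,
    Fintype.card_fin] at hvol
  rw [← ENNReal.ofReal_pow (by linarith), ← ENNReal.ofReal_mul (by norm_num)] at hvol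
  calc _ ≤ ((n + 2 : ℕ) : ENNReal) *
        ENNReal.ofReal ((1 - -1) * (2 * r - -(2 * r)) ^ (n + 1)) := by gcongr
    _ = ENNReal.ofReal ((n + 2 : ℕ) : ℝ) * _ := by rw [ENNReal.ofReal_natCast]
    _ = _ := by
      rw [← ENNReal.ofReal_mul (by positivity)]
      congr 1
      push_cast
      rw [show 2 * r - -(2 * r) = 4 * r by ring, mul_pow]
      ring

/-- A spherical annulus of opening `r ≤ 1/6` has surface at least `c r^(d-1)`. -/
theorem exists_le_annulus {d : ℕ} (hd : 2 ≤ d) : ∃ c : ℝ, 0 < c ∧ ∀ ω : Vel d, ‖ω‖ = 1 →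
    ∀ r : ℝ, 0 < r → r ≤ 1 / 6 →
      ENNReal.ofReal (c * r ^ (d - 1)) ≤
        surfaceMeasure d {σ : Sph d | r ^ 2 ≤ 1 - inner ℝ ω (σ : Vel d) ∧
          1 - inner ℝ ω (σ : Vel d) ≤ 16 * r ^ 2} := by
  obtain ⟨n, rfl⟩ : ∃ n, d = n + 2 := ⟨d - 2, by omega⟩
  refine ⟨(n + 2) * ((1 / 4) * ((1 / 5) * (1 / (n + 2)) ^ n)), by positivity, fun ω hω r hr hr6 => ?_⟩
  obtain ⟨B, hB⟩ := exists_orthonormalBasis_zero_eq hω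
  rw [surfaceMeasure_apply (measurableSet_cap ω _ _)]
  -- The box keeps the axial coordinate in `[1/4, 1/2]`. The second coordinate alone gives a
  -- transverse norm at least `r`, and the widths are small enough that its square stays below `2
  -- r²`. With `r ≤ 1/6` the box lies in the unit ball.
  set lo : Fin (n + 2) → ℝ := Fin.cons (1 / 4) (Fin.cons r fun _ => 0) with hlo
  set hi : Fin (n + 2) → ℝ := Fin.cons (1 / 2) (Fin.cons (6 / 5 * r) fun _ => r / (n + 2)) with hhi
  have hsub : {x | ∀ i, B.repr x i ∈ Icc (lo i) (hi i)} ⊆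
      (Ioo (0 : ℝ) 1 • ((↑) '' {σ : Sph (n + 2) | r ^ 2 ≤ 1 - inner ℝ ω (σ : Vel (n + 2)) ∧
        1 - inner ℝ ω (σ : Vel (n + 2)) ≤ 16 * r ^ 2} : Set (Vel (n + 2)))) := by
    intro x hx
    have hN := norm_sq_eq_sum_repr B x
    have h0 : B.repr x 0 = inner ℝ ω x := by rw [B.repr_apply_apply, hB]
    have hx0 := hx 0
    have hx1 := hx 1
    have hx2 : ∀ j : Fin n, B.repr x j.succ.succ ∈ Icc 0 (r / (n + 2)) := fun j => by
      simpa [hlo, hhi] using hx j.succ.succ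
    simp only [hlo, hhi, Fin.cons_zero, mem_Icc] at hx0
    rw [show (1 : Fin (n + 2)) = Fin.succ 0 from rfl] at hx1
    simp only [hlo, hhi, Fin.cons_succ, Fin.cons_zero, mem_Icc] at hx1
    rw [Fin.sum_univ_succ] at hN
    set y1 := B.repr x (Fin.succ 0)
    set x0 := B.repr x 0
    have hT : ∑ j : Fin n, B.repr x j.succ.succ ^ 2 ≤ r ^ 2 / 4 := by
      calc ∑ j : Fin n, B.repr x j.succ.succ ^ 2 ≤ ∑ j : Fin n, (r / (n + 2)) ^ 2 :=
            Finset.sum_le_sum fun j _ => pow_le_pow_left₀ (hx2 j).1 (hx2 j).2 2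
        _ = r ^ 2 * (n / (n + 2) ^ 2) := by simp [div_pow]; ring
        _ ≤ r ^ 2 * (1 / 4) := by
          refine mul_le_mul_of_nonneg_left ?_ (sq_nonneg r)
          rw [div_le_iff₀ (by positivity)]
          nlinarith [sq_nonneg ((n : ℝ) - 2)]
        _ = _ := by ring
    have hT0 : 0 ≤ ∑ j : Fin n, B.repr x j.succ.succ ^ 2 := Finset.sum_nonneg fun _ _ => sq_nonneg _
    set T := ∑ j : Fin n, B.repr x j.succ.succ ^ 2
    have hr2 : r ^ 2 ≤ 1 / 36 := by nlinarith
    have hY1 : r ^ 2 ≤ y1 ^ 2 + T := by nlinarith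
    have hY2 : y1 ^ 2 + T ≤ 2 * r ^ 2 := by nlinarith
    set Y := y1 ^ 2 + T
    have hNpos : 0 < ‖x‖ := by
      rw [norm_pos_iff]; rintro rfl
      simp only [norm_zero] at hN
      nlinarith
    have hN1 : ‖x‖ < 1 := by nlinarith
    have hs : ‖‖x‖⁻¹ • x‖ = 1 := by rw [norm_smul, norm_inv, norm_norm, inv_mul_cancel₀ hNpos.ne']
    refine ⟨‖x‖, ⟨hNpos, hN1⟩, ‖x‖⁻¹ • x, ⟨⟨‖x‖⁻¹ • x, by simpa using hs⟩, ?_, rfl⟩, ?_⟩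
    · simp only [mem_ofPred_eq, inner_smul_right, ← h0]
      have hle : x0 ≤ ‖x‖ := by nlinarith
      -- Hence `1 - cos = Y / (‖x‖ (‖x‖ + x0))`, with `r² ≤ Y ≤ 2 r²` and a denominator between
      -- `1/8` and `1`.
      have key : (‖x‖ - x0) * (‖x‖ + x0) = Y := by linear_combination hN
      rw [show 1 - ‖x‖⁻¹ * x0 = (‖x‖ - x0) / ‖x‖ by field_simp, le_div_iff₀ hNpos,
        div_le_iff₀ hNpos]
      have hup : ‖x‖ ≤ 3 / 5 := by nlinarith
      constructor
      · have : r ^ 2 * ‖x‖ * (‖x‖ + x0) ≤ (‖x‖ - x0) * (‖x‖ + x0) := by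
          rw [key]
          have : ‖x‖ * (‖x‖ + x0) ≤ 1 := by nlinarith
          nlinarith [sq_nonneg r]
        exact le_of_mul_le_mul_right this (by linarith)
      · have : (‖x‖ - x0) * (‖x‖ + x0) ≤ 16 * r ^ 2 * ‖x‖ * (‖x‖ + x0) := by
          rw [key]
          have : 1 / 8 ≤ ‖x‖ * (‖x‖ + x0) := by nlinarith
          nlinarith [sq_nonneg r]
        exact le_of_mul_le_mul_right this (by linarith)
    · exact smul_inv_smul₀ hNpos.ne' x
  have hvol := (volume_box B _ _).symm.trans_le (measure_mono hsub)
  rw [Fin.prod_univ_succ, Fin.prod_univ_succ] at hvol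
  simp only [hlo, hhi, Fin.cons_zero, Fin.cons_succ, Finset.prod_const, Finset.card_univ,
    Fintype.card_fin] at hvol
  rw [← ENNReal.ofReal_pow (by rw [sub_zero]; positivity), ← ENNReal.ofReal_mul (by linarith),
    ← ENNReal.ofReal_mul (by norm_num)] at hvol
  calc _ = ENNReal.ofReal ((n + 2 : ℕ) : ℝ) *
        ENNReal.ofReal ((1 / 2 - 1 / 4) * ((6 / 5 * r - r) * (r / (n + 2) - 0) ^ n)) := by
        rw [← ENNReal.ofReal_mul (by positivity)]
        congr 1
        push_cast
        rw [show r ^ (n + 1) = r * r ^ n from pow_succ' r n, sub_zero, div_pow, div_pow, one_pow]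
        ring
    _ = ((n + 2 : ℕ) : ENNReal) * _ := by rw [ENNReal.ofReal_natCast]
    _ ≤ _ := by gcongr

/-! ### The displacement at fixed `σ`: inverse, volume and null sets -/

/-- The displacement `v' - v` as a function of the relative velocity `u = v - v_*`. -/
noncomputable def shift {d : ℕ} (σ u : Vel d) : Vel d := (1 / 2 : ℝ) • (‖u‖ • σ - u)

theorem vPrime_eq {d : ℕ} (v vs : Vel d) (σ : Sph d) :
    vPrime v vs σ = v + shift (σ : Vel d) (v - vs) := by
  simp only [vPrime, shift]
  module

theorem norm_sph {d : ℕ} (σ : Sph d) : ‖(σ : Vel d)‖ = 1 := by simp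

theorem norm_shift_sq {d : ℕ} {σ : Vel d} (hσ : ‖σ‖ = 1) (u : Vel d) :
    ‖shift σ u‖ ^ 2 = ‖u‖ * (‖u‖ - inner ℝ σ u) / 2 := by
  rw [shift, norm_smul, mul_pow, norm_sub_sq_real, norm_smul, inner_smul_left, hσ]
  simp
  ring

theorem inner_shift {d : ℕ} {σ : Vel d} (hσ : ‖σ‖ = 1) (u : Vel d) :
    inner ℝ σ (shift σ u) = (‖u‖ - inner ℝ σ u) / 2 := by
  rw [shift, inner_smul_right, inner_sub_right, inner_smul_right, real_inner_self_eq_norm_sq, hσ]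
  ring

/-- The maps `u ↦ ‖u‖ σ` and `u ↦ u` are both 1-Lipschitz, and the factor `1/2` offsets their sum.
This property takes the place of a Jacobian computation. -/
theorem lipschitzWith_shift {d : ℕ} {σ : Vel d} (hσ : ‖σ‖ = 1) : LipschitzWith 1 (shift σ) := by
  refine LipschitzWith.of_dist_le_mul fun a b => ?_
  rw [dist_eq_norm, dist_eq_norm, shift, shift,
    show (1 / 2 : ℝ) • (‖a‖ • σ - a) - (1 / 2 : ℝ) • (‖b‖ • σ - b) =
      (1 / 2 : ℝ) • ((‖a‖ - ‖b‖) • σ - (a - b)) by module, norm_smul]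
  have h1 := norm_sub_le ((‖a‖ - ‖b‖) • σ) (a - b)
  have h2 := abs_norm_sub_norm_le a b
  rw [norm_smul, hσ, Real.norm_eq_abs] at h1
  rw [Real.norm_of_nonneg (by norm_num)]
  push_cast
  linarith

/-- Lebesgue measure is a multiple of the `d`-dimensional Hausdorff measure, which 1-Lipschitz maps
do not increase. -/
theorem volume_image_le_of_lipschitzWith_one {d : ℕ} {f : Vel d → Vel d} (hf : LipschitzWith 1 f)
    (s : Set (Vel d)) : volume (f '' s) ≤ volume s := by
  have h := Measure.isAddLeftInvariant_eq_smul (volume : Measure (Vel d)) μH[(d : ℝ)]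
  rw [h, Measure.smul_apply, Measure.smul_apply]
  have h1 := hf.hausdorffMeasure_image_le (Nat.cast_nonneg d) s
  simp only [ENNReal.coe_one, ENNReal.one_rpow, one_mul] at h1
  gcongr

/-- A right inverse of `shift σ` on the half space `⟪σ, w⟫ ≠ 0`. -/
noncomputable def shiftInv {d : ℕ} (σ w : Vel d) : Vel d :=
  (‖w‖ ^ 2 / inner ℝ σ w) • σ - (2 : ℝ) • w

theorem norm_shiftInv {d : ℕ} {σ : Vel d} (hσ : ‖σ‖ = 1) {w : Vel d} (hw : 0 < inner ℝ σ w) :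
    ‖shiftInv σ w‖ = ‖w‖ ^ 2 / inner ℝ σ w := by
  have h : ‖shiftInv σ w‖ ^ 2 = (‖w‖ ^ 2 / inner ℝ σ w) ^ 2 := by
    rw [shiftInv, norm_sub_sq_real, norm_smul, norm_smul, inner_smul_left, inner_smul_right, hσ]
    simp only [Real.norm_eq_abs, mul_one, sq_abs, conj_trivial, abs_two]
    field_simp
    ring
  exact (pow_left_inj₀ (norm_nonneg _) (by positivity) two_ne_zero).1 h

theorem shift_shiftInv {d : ℕ} {σ : Vel d} (hσ : ‖σ‖ = 1) {w : Vel d} (hw : 0 < inner ℝ σ w) :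
    shift σ (shiftInv σ w) = w := by
  rw [shift, norm_shiftInv hσ hw, shiftInv]
  module

theorem shiftInv_shift {d : ℕ} {σ : Vel d} (hσ : ‖σ‖ = 1) {u : Vel d}
    (hu : inner ℝ σ (shift σ u) ≠ 0) : shiftInv σ (shift σ u) = u := by
  have h : ‖shift σ u‖ ^ 2 / inner ℝ σ (shift σ u) = ‖u‖ := by
    rw [div_eq_iff hu, norm_shift_sq hσ, inner_shift hσ]
    ring
  rw [shiftInv, h, shift]
  module

theorem continuous_shift {d : ℕ} : Continuous fun p : Vel d × Vel d => shift p.1 p.2 := by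
  unfold shift
  fun_prop

/-- The push-forward of Lebesgue measure by a volume non-increasing map dominates Lebesgue measure
on the image. The set on the left consists of the `w` with `σ · w > 0` whose preimage `shiftInv σ
w`, of norm `‖w‖² / (σ · w)`, lies in the ball of radius `K`. -/
theorem lintegral_le_lintegral_shift {d : ℕ} {σ : Vel d} (hσ : ‖σ‖ = 1) {K : ℝ} (hK : 0 < K)
    {G : Vel d → ENNReal} (hG : Measurable G) :
    ∫⁻ w in {w | ‖w‖ ^ 2 < K * inner ℝ σ w}, G w ≤
      ∫⁻ u in Metric.ball 0 K, G (shift σ u) := by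
  have hm : Measurable (shift σ) := (lipschitzWith_shift hσ).continuous.measurable
  rw [← lintegral_map hG hm]
  refine lintegral_mono' ?_ le_rfl
  refine Measure.le_iff.2 fun B hB => ?_
  rw [Measure.restrict_apply hB, Measure.map_apply hm hB, Measure.restrict_apply (hm hB)]
  refine (measure_mono ?_).trans (volume_image_le_of_lipschitzWith_one (lipschitzWith_shift hσ) _)
  rintro w ⟨hwB, hw⟩
  rw [mem_ofPred_eq] at hw
  have hpos : 0 < inner ℝ σ w := pos_of_mul_pos_right ((sq_nonneg _).trans_lt hw) hK.le
  refine ⟨shiftInv σ w, ⟨?_, ?_⟩, shift_shiftInv hσ hpos⟩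
  · rwa [mem_preimage, shift_shiftInv hσ hpos]
  · rw [mem_ball_zero_iff, norm_shiftInv hσ hpos, div_lt_iff₀ hpos]
    exact hw

/-- The displacements `v' - v` with bounded relative velocity fill a ball. -/
theorem exists_lintegral_ball_le {d : ℕ} (hd : 2 ≤ d) : ∃ c : ℝ, 0 < c ∧ ∀ K : ℝ, 0 < K →
    ∀ G : Vel d → ENNReal, Measurable G →
      ENNReal.ofReal c * ∫⁻ w in Metric.ball 0 (K / 2), G w ≤
        ∫⁻ u in Metric.ball 0 K, ∫⁻ σ, G (shift (σ : Vel d) u) ∂(surfaceMeasure d) := by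
  obtain ⟨c, hc, hcap⟩ := exists_le_annulus hd
  refine ⟨c * (1 / 6) ^ (d - 1), by positivity, fun K hK G hG => ?_⟩
  have hGm : Measurable fun p : Vel d × Sph d => G (shift (p.2 : Vel d) p.1) := by
    refine hG.comp (continuous_shift.comp (?_ : Continuous fun p : Vel d × Sph d =>
      ((p.2 : Vel d), p.1))).measurable
    fun_prop
  have hT : MeasurableSet {p : Vel d × Sph d | ‖p.1‖ ^ 2 < K * inner ℝ (p.2 : Vel d) p.1} :=
    (isOpen_lt (by fun_prop) (by fun_prop)).measurableSet
  rw [lintegral_lintegral_swap hGm.aemeasurable, ← lintegral_const_mul _ hG]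
  calc ∫⁻ w in Metric.ball 0 (K / 2), ENNReal.ofReal (c * (1 / 6) ^ (d - 1)) * G w
      = ∫⁻ w, (Metric.ball 0 (K / 2)).indicator
          (fun w => ENNReal.ofReal (c * (1 / 6) ^ (d - 1)) * G w) w := by
        rw [lintegral_indicator measurableSet_ball]
    _ ≤ ∫⁻ w, ∫⁻ σ : Sph d, {p : Vel d × Sph d | ‖p.1‖ ^ 2 < K * inner ℝ (p.2 : Vel d) p.1}.indicator
          (fun p => G p.1) (w, σ) ∂(surfaceMeasure d) := by
        refine lintegral_mono_ae ?_
        have h0 : ∀ᵐ w : Vel d, w ≠ 0 := by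
          have : Nontrivial (Vel d) := by
            have : Nonempty (Fin d) := ⟨⟨0, by omega⟩⟩
            infer_instance
          exact Measure.ae_ne volume 0
        filter_upwards [h0] with w hw
        by_cases hwK : w ∈ Metric.ball (0 : Vel d) (K / 2)
        swap
        · rw [indicator_of_notMem hwK]; exact bot_le
        rw [indicator_of_mem hwK]
        have hwpos : 0 < ‖w‖ := norm_pos_iff.2 hw
        have hω : ‖‖w‖⁻¹ • w‖ = 1 := by
          rw [norm_smul, norm_inv, norm_norm, inv_mul_cancel₀ hwpos.ne']
        rw [mem_ball_zero_iff] at hwK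
        -- With opening `1/6` the annulus satisfies `1 - cos ≤ 16/36 < 1/2`. Then `σ · w > ‖w‖ / 2`,
        -- which together with `‖w‖ < K / 2` gives `‖w‖² < K (σ · w)`.
        refine (mul_le_mul_left (hcap _ hω (1 / 6) (by norm_num) le_rfl) (G w)).trans ?_
        rw [mul_comm, ← lintegral_indicator_const (measurableSet_cap _ _ _)]
        refine lintegral_mono fun σ' => ?_
        by_cases hσ' : σ' ∈ {σ : Sph d | (1 / 6 : ℝ) ^ 2 ≤ 1 - inner ℝ (‖w‖⁻¹ • w) (σ : Vel d) ∧
            1 - inner ℝ (‖w‖⁻¹ • w) (σ : Vel d) ≤ 16 * (1 / 6) ^ 2}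
        swap
        · rw [indicator_of_notMem hσ']; exact bot_le
        rw [indicator_of_mem hσ']
        rw [indicator_of_mem]
        have h2 := hσ'.2
        rw [inner_smul_left, real_inner_comm] at h2
        simp only [conj_trivial] at h2
        have h3 : ‖w‖ * (1 / 2) < inner ℝ (σ' : Vel d) w := by
          have h4 : 1 / 2 < ‖w‖⁻¹ * inner ℝ (σ' : Vel d) w := by linarith
          rw [inv_mul_eq_div, lt_div_iff₀ hwpos] at h4
          linarith
        rw [mem_ofPred_eq]
        nlinarith
    _ = ∫⁻ σ : Sph d, ∫⁻ w : Vel d, {p : Vel d × Sph d | ‖p.1‖ ^ 2 < K * inner ℝ (p.2 : Vel d) p.1}.indicator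
          (fun p => G p.1) (w, σ) ∂volume ∂(surfaceMeasure d) := by
        refine lintegral_lintegral_swap (Measurable.aemeasurable ?_)
        exact (hG.comp measurable_fst).indicator hT
    _ ≤ _ := by
        refine lintegral_mono fun σ => ?_
        refine le_trans (le_of_eq ?_) (lintegral_le_lintegral_shift (norm_sph σ) hK hG)
        rw [← lintegral_indicator]
        · rfl
        · exact (isOpen_lt (by fun_prop) (by fun_prop)).measurableSet

/-- Off the hyperplane `σ · w = 0` the inverse is differentiable and so maps null sets to null sets.
The remaining `u` are multiples of `σ`, and a line is null because `d ≥ 2`. This is what makes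
increments independent of the representative of `f`. -/
theorem volume_preimage_shift {d : ℕ} (hd : 2 ≤ d) {σ : Vel d} (hσ : ‖σ‖ = 1) {N : Set (Vel d)}
    (hN : volume N = 0) : volume (shift σ ⁻¹' N) = 0 := by
  have h1 : volume (shiftInv σ '' (N ∩ {w | inner ℝ σ w ≠ 0})) = 0 := by
    refine addHaar_image_eq_zero_of_differentiableOn_of_addHaar_eq_zero volume ?_
      (measure_mono_null inter_subset_left hN)
    intro w hw
    unfold shiftInv
    simp only [div_eq_mul_inv]
    refine DifferentiableAt.differentiableWithinAt ?_
    have hw' : inner ℝ σ w ≠ 0 := hw.2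
    have hn : DifferentiableAt ℝ (fun w : Vel d => ‖w‖ ^ 2) w := (contDiff_norm_sq ℝ).differentiable one_ne_zero w
    have hi : DifferentiableAt ℝ (fun w : Vel d => inner ℝ σ w) w :=
      (innerSL ℝ σ).differentiableAt
    exact (((hn.mul (hi.inv hw') : DifferentiableAt ℝ
      (fun w : Vel d => ‖w‖ ^ 2 * (inner ℝ σ w)⁻¹) w)).smul_const σ).sub (differentiableAt_id.const_smul (2 : ℝ))
  have h2 : volume ((Submodule.span ℝ {σ} : Submodule ℝ (Vel d)) : Set (Vel d)) = 0 := by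
    refine Measure.addHaar_submodule volume _ fun h => ?_
    have h3 := finrank_span_le_card (R := ℝ) ({σ} : Set (Vel d))
    rw [h] at h3
    simp at h3
    omega
  refine measure_mono_null ?_ (measure_union_null h1 h2)
  intro u hu
  by_cases h : inner ℝ σ (shift σ u) = 0
  · right
    have h4 : ‖shift σ u‖ ^ 2 = 0 := by
      rw [norm_shift_sq hσ]
      rw [inner_shift hσ] at h
      have : ‖u‖ - inner ℝ σ u = 0 := by linarith
      rw [this]; ring
    have h5 : shift σ u = 0 := by simpa using h4
    rw [shift, smul_eq_zero, sub_eq_zero] at h5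
    rcases h5 with h5 | h5
    · norm_num at h5
    · rw [← h5]
      exact Submodule.smul_mem _ _ (Submodule.mem_span_singleton_self σ)
  · left
    exact ⟨shift σ u, ⟨hu, h⟩, shiftInv_shift hσ h⟩

theorem measurable_vPrime {d : ℕ} :
    Measurable fun p : Vel d × Vel d × Sph d => vPrime p.1 p.2.1 p.2.2 := by
  refine Continuous.measurable ?_
  unfold vPrime
  fun_prop

/-- The map `(v, v_*, σ) ↦ v'` is non-singular. -/
theorem quasiMeasurePreserving_vPrime {d : ℕ} (hd : 2 ≤ d) :
    Measure.QuasiMeasurePreserving (fun p : Vel d × Vel d × Sph d => vPrime p.1 p.2.1 p.2.2)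
      (collMeasure d) volume := by
  refine ⟨measurable_vPrime, Measure.AbsolutelyContinuous.mk fun N hN h0 => ?_⟩
  rw [Measure.map_apply measurable_vPrime hN, collMeasure,
    Measure.measure_prod_null (measurable_vPrime hN)]
  refine Filter.Eventually.of_forall fun v => ?_
  have hm : MeasurableSet (Prod.mk v ⁻¹' ((fun p : Vel d × Vel d × Sph d =>
      vPrime p.1 p.2.1 p.2.2) ⁻¹' N)) := measurable_prodMk_left (measurable_vPrime hN)
  change (volume.prod (surfaceMeasure d)) _ = 0
  rw [Measure.prod_apply_symm hm]
  refine (lintegral_eq_zero_iff' ?_).2 (Filter.Eventually.of_forall fun σ => ?_)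
  · exact (measurable_measure_prodMk_right hm).aemeasurable
  · have h1 : volume ((fun w : Vel d => v + w) ⁻¹' N) = 0 := by
      rw [measure_preimage_add]; exact h0
    have h2 := volume_preimage_shift hd (norm_sph σ) h1
    have h3 : volume ((fun vs : Vel d => v - vs) ⁻¹'
        (shift (σ : Vel d) ⁻¹' ((fun w : Vel d => v + w) ⁻¹' N))) = 0 := by
      rw [(Measure.measurePreserving_sub_left (volume : Measure (Vel d)) v).measure_preimage]
      · exact h2
      · exact NullMeasurableSet.of_null h2
    refine measure_mono_null ?_ h3
    intro vs hvs
    simpa [vPrime_eq] using hvs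

theorem quasiMeasurePreserving_fst {d : ℕ} :
    Measure.QuasiMeasurePreserving (fun p : Vel d × Vel d × Sph d => p.1) (collMeasure d) volume :=
  Measure.quasiMeasurePreserving_fst

/-! ### Changes of variables in the collision integral -/

/-- Polar coordinates for nonnegative functions. -/
theorem lintegral_polar {d : ℕ} {F : Vel d → ENNReal} (hd : 2 ≤ d) (hF : Measurable F) :
    ∫⁻ u, F u = ∫⁻ r : Ioi (0 : ℝ), ∫⁻ ω : Sph d, F ((r : ℝ) • (ω : Vel d)) ∂(surfaceMeasure d)
      ∂(Measure.volumeIoiPow (d - 1)) := by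
  have : Nontrivial (Vel d) := by
    have : Nonempty (Fin d) := ⟨⟨0, by omega⟩⟩
    infer_instance
  have hmp := (volume : Measure (Vel d)).measurePreserving_homeomorphUnitSphereProd
  rw [show Module.finrank ℝ (Vel d) = d by simp] at hmp
  have h1 : ∫⁻ u, F u = ∫⁻ u : ({0}ᶜ : Set (Vel d)), F u ∂(Measure.comap Subtype.val volume) := by
    rw [lintegral_subtype_comap (measurableSet_singleton _).compl, restrict_compl_singleton]
  have hm : Measurable fun p : Sph d × Ioi (0 : ℝ) => F ((p.2 : ℝ) • (p.1 : Vel d)) :=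
    hF.comp (by fun_prop)
  rw [h1]
  calc _ = ∫⁻ u : ({0}ᶜ : Set (Vel d)), (fun p : Sph d × Ioi (0 : ℝ) => F ((p.2 : ℝ) • (p.1 : Vel d)))
        (homeomorphUnitSphereProd (Vel d) u) ∂(Measure.comap Subtype.val volume) := by
        refine lintegral_congr fun u => ?_
        congr 1
        simpa using (smul_inv_smul₀ (norm_ne_zero_iff.2 u.2) (u : Vel d)).symm
    _ = ∫⁻ p, F ((p.2 : ℝ) • (p.1 : Vel d)) ∂((surfaceMeasure d).prod
          (Measure.volumeIoiPow (d - 1))) := hmp.lintegral_comp hm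
    _ = _ := lintegral_prod_symm' _ hm

theorem lintegral_collMeasure {d : ℕ} {F : Vel d × Vel d × Sph d → ENNReal} (hF : Measurable F) :
    ∫⁻ p, F p ∂(collMeasure d) = ∫⁻ v, ∫⁻ vs, ∫⁻ σ, F (v, vs, σ) ∂(surfaceMeasure d) := by
  rw [collMeasure, lintegral_prod _ hF.aemeasurable]
  refine lintegral_congr fun v => ?_
  exact lintegral_prod _ (hF.comp measurable_prodMk_left).aemeasurable

/-- Integration in relative velocity. -/
theorem lintegral_collMeasure_relative {d : ℕ} {F : Vel d × Vel d × Sph d → ENNReal}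
    (hF : Measurable F) :
    ∫⁻ p, F p ∂(collMeasure d) = ∫⁻ v, ∫⁻ u, ∫⁻ σ, F (v, v - u, σ) ∂(surfaceMeasure d) := by
  rw [lintegral_collMeasure hF]
  refine lintegral_congr fun v => ?_
  exact (lintegral_sub_left_eq_self (μ := volume)
    (fun vs => ∫⁻ σ, F (v, vs, σ) ∂(surfaceMeasure d)) v).symm

/-- Integration in the centre of mass frame. -/
theorem lintegral_collMeasure_center {d : ℕ} (hd : 2 ≤ d)
    {F : Vel d × Vel d × Sph d → ENNReal} (hF : Measurable F) :
    ∫⁻ p, F p ∂(collMeasure d) = ∫⁻ r : Ioi (0 : ℝ), ∫⁻ z, ∫⁻ ω : Sph d, ∫⁻ σ : Sph d,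
      F (z + ((r : ℝ) / 2) • (ω : Vel d), z - ((r : ℝ) / 2) • (ω : Vel d), σ) ∂(surfaceMeasure d)
        ∂(surfaceMeasure d) ∂volume ∂(Measure.volumeIoiPow (d - 1)) := by
  rw [lintegral_collMeasure_relative hF]
  have h1 : Measurable fun p : Vel d × Vel d => ∫⁻ σ, F (p.1, p.1 - p.2, σ) ∂(surfaceMeasure d) := by
    refine Measurable.lintegral_prod_right' (f := fun q : (Vel d × Vel d) × Sph d =>
      F (q.1.1, q.1.1 - q.1.2, q.2)) (hF.comp (by fun_prop))
  have h2 : Measurable fun p : Vel d × Vel d => ∫⁻ σ,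
      F (p.1 + (1 / 2 : ℝ) • p.2, p.1 - (1 / 2 : ℝ) • p.2, σ) ∂(surfaceMeasure d) := by
    refine Measurable.lintegral_prod_right' (f := fun q : (Vel d × Vel d) × Sph d =>
      F (q.1.1 + (1 / 2 : ℝ) • q.1.2, q.1.1 - (1 / 2 : ℝ) • q.1.2, q.2)) (hF.comp (by fun_prop))
  rw [lintegral_lintegral_swap h1.aemeasurable]
  have h3 : ∀ u : Vel d, ∫⁻ v, ∫⁻ σ, F (v, v - u, σ) ∂(surfaceMeasure d) =
      ∫⁻ z, ∫⁻ σ, F (z + (1 / 2 : ℝ) • u, z - (1 / 2 : ℝ) • u, σ) ∂(surfaceMeasure d) := by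
    intro u
    rw [← lintegral_add_right_eq_self (μ := volume) _ ((1 / 2 : ℝ) • u)]
    refine lintegral_congr fun z => lintegral_congr fun σ => ?_
    rw [show z + (1 / 2 : ℝ) • u - u = z - (1 / 2 : ℝ) • u by module]
  simp_rw [h3]
  rw [lintegral_polar hd (h2.lintegral_prod_left')]
  refine lintegral_congr fun r => ?_
  rw [lintegral_lintegral_swap]
  · refine lintegral_congr fun z => lintegral_congr fun ω => lintegral_congr fun σ => ?_
    rw [smul_smul, show (1 / 2 : ℝ) * (r : ℝ) = (r : ℝ) / 2 by ring]
  · exact (h2.comp (f := fun p : Sph d × Vel d => (p.2, (r : ℝ) • (p.1 : Vel d)))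
      (by fun_prop)).aemeasurable

theorem measurable_cosTheta {d : ℕ} :
    Measurable fun p : Vel d × Vel d × Sph d => cosTheta p.1 p.2.1 p.2.2 := by
  unfold cosTheta
  refine Measurable.div ?_ ?_ <;> exact Continuous.measurable (by fun_prop)

theorem continuous_maxwellian {d : ℕ} : Continuous (maxwellian : Vel d → ℝ) := by
  unfold maxwellian
  fun_prop

theorem maxwellian_pos {d : ℕ} (v : Vel d) : 0 < maxwellian v := by
  unfold maxwellian
  positivity

theorem maxwellian_mul_maxwellian {d : ℕ} (v w : Vel d) :
    maxwellian v * maxwellian w = (1 / (2 * Real.pi) ^ ((d : ℝ) / 2)) ^ 2 *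
      Real.exp (-(‖v‖ ^ 2 + ‖w‖ ^ 2) / 2) := by
  rw [maxwellian, maxwellian, show -(‖v‖ ^ 2 + ‖w‖ ^ 2) / 2 = -‖v‖ ^ 2 / 2 + -‖w‖ ^ 2 / 2 by ring,
    Real.exp_add]
  ring

/-- The exchange of pre- and post-collisional velocities preserves the collision integrals whose
kernel depends on the relative speed and the deviation angle only. -/
theorem lintegral_swap_collision {d : ℕ} (hd : 2 ≤ d) {k : ℝ × ℝ → ENNReal} (hk : Measurable k)
    {H : Vel d × Vel d → ENNReal} (hH : Measurable H) :
    ∫⁻ p : Vel d × Vel d × Sph d, k (‖p.1 - p.2.1‖, cosTheta p.1 p.2.1 p.2.2) *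
        ENNReal.ofReal (maxwellian p.1 * maxwellian p.2.1) * H (vPrime p.1 p.2.1 p.2.2, p.1)
        ∂(collMeasure d) =
      ∫⁻ p : Vel d × Vel d × Sph d, k (‖p.1 - p.2.1‖, cosTheta p.1 p.2.1 p.2.2) *
        ENNReal.ofReal (maxwellian p.1 * maxwellian p.2.1) * H (p.1, vPrime p.1 p.2.1 p.2.2)
        ∂(collMeasure d) := by
  have hA : Measurable fun p : Vel d × Vel d × Sph d => k (‖p.1 - p.2.1‖, cosTheta p.1 p.2.1 p.2.2) *
      ENNReal.ofReal (maxwellian p.1 * maxwellian p.2.1) := by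
    refine Measurable.mul (hk.comp (Measurable.prodMk (by fun_prop) measurable_cosTheta)) ?_
    exact ENNReal.measurable_ofReal.comp (Continuous.measurable
      ((continuous_maxwellian.comp (by fun_prop)).mul (continuous_maxwellian.comp (by fun_prop))))
  refine (lintegral_collMeasure_center hd
    (hA.mul (hH.comp (measurable_vPrime.prodMk measurable_fst)))).trans
    (Eq.trans ?_ (lintegral_collMeasure_center hd
      (hA.mul (hH.comp (measurable_fst.prodMk measurable_vPrime)))).symm)
  refine lintegral_congr fun r => lintegral_congr fun z => ?_
  have hr : (0 : ℝ) < r := r.2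
  -- With `v = z + (r/2) ω` and `v_* = z - (r/2) ω` one has `v' = z + (r/2) σ` and `cos θ = ω · σ`,
  -- while `M M_*` depends on `z` and `r` only. The exchange of `v` and `v'` is then the exchange of
  -- `ω` and `σ`.
  set a : Sph d → Vel d := fun ω => z + ((r : ℝ) / 2) • (ω : Vel d) with ha
  set a' : Sph d → Vel d := fun ω => z - ((r : ℝ) / 2) • (ω : Vel d) with ha'
  have h1 : ∀ ω : Sph d, a ω - a' ω = (r : ℝ) • (ω : Vel d) := fun ω => by
    simp only [ha, ha']; module
  have h2 : ∀ ω : Sph d, ‖a ω - a' ω‖ = r := fun ω => by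
    rw [h1, norm_smul, norm_sph, mul_one, Real.norm_of_nonneg hr.le]
  have h3 : ∀ ω σ : Sph d, vPrime (a ω) (a' ω) σ = a σ := fun ω σ => by
    rw [vPrime, h2]
    simp only [ha, ha']
    module
  have h4 : ∀ ω σ : Sph d, cosTheta (a ω) (a' ω) σ = inner ℝ (ω : Vel d) (σ : Vel d) := fun ω σ => by
    rw [cosTheta, h2, h1, inner_smul_left]
    simp only [conj_trivial]
    field_simp
  have h5 : ∀ ω σ : Sph d, maxwellian (a ω) * maxwellian (a' ω) = maxwellian (a σ) * maxwellian (a' σ) := by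
    intro ω σ
    have : ∀ ω : Sph d, ‖a ω‖ ^ 2 + ‖a' ω‖ ^ 2 = 2 * ‖z‖ ^ 2 + r ^ 2 / 2 := by
      intro ω
      simp only [ha, ha']
      rw [norm_add_sq_real, norm_sub_sq_real, norm_smul, norm_sph, mul_one,
        Real.norm_of_nonneg (by positivity)]
      ring
    rw [maxwellian_mul_maxwellian, maxwellian_mul_maxwellian, this, this]
  change ∫⁻ ω : Sph d, ∫⁻ σ : Sph d, k (‖a ω - a' ω‖, cosTheta (a ω) (a' ω) σ) *
    ENNReal.ofReal (maxwellian (a ω) * maxwellian (a' ω)) * H (vPrime (a ω) (a' ω) σ, a ω)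
      ∂(surfaceMeasure d) ∂(surfaceMeasure d) =
    ∫⁻ ω : Sph d, ∫⁻ σ : Sph d, k (‖a ω - a' ω‖, cosTheta (a ω) (a' ω) σ) *
    ENNReal.ofReal (maxwellian (a ω) * maxwellian (a' ω)) * H (a ω, vPrime (a ω) (a' ω) σ)
      ∂(surfaceMeasure d) ∂(surfaceMeasure d)
  simp_rw [h2, h3, h4]
  have hca : Continuous a := by fun_prop
  have hca' : Continuous a' := by fun_prop
  rw [lintegral_lintegral_swap]
  · refine lintegral_congr fun σ => lintegral_congr fun ω => ?_
    rw [real_inner_comm, h5 ω σ]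
  · refine Measurable.aemeasurable (Measurable.mul (Measurable.mul (hk.comp ?_) ?_) (hH.comp ?_))
    · exact Continuous.measurable (by fun_prop)
    · exact ENNReal.measurable_ofReal.comp (Continuous.measurable
        ((continuous_maxwellian.comp (by fun_prop)).mul (continuous_maxwellian.comp (by fun_prop))))
    · exact Continuous.measurable (by fun_prop)

/-! ### Comparison of kernels with the Dirichlet form -/

/-- Lower bound of the angular kernel in terms of `1 - cos θ`. -/
theorem exists_angular_lower_bound {d : ℕ} {ν c₀ : ℝ} (hd : 2 ≤ d) (hν : 0 < ν) (hc₀ : 0 < c₀)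
    {b : ℝ → ℝ}
    (hbθ : ∀ θ ∈ Set.Ioc (0 : ℝ) Real.pi, c₀ * θ ^ (-((d : ℝ) - 1) - ν) ≤ b (Real.cos θ)) :
    ∃ c : ℝ, 0 < c ∧ ∀ x, -1 ≤ x → x < 1 → c * (1 - x) ^ (-(((d : ℝ) - 1 + ν) / 2)) ≤ b x := by
  have hd' : (2 : ℝ) ≤ d := by exact_mod_cast hd
  refine ⟨c₀ * (Real.pi ^ 2 / 2) ^ (-(((d : ℝ) - 1 + ν) / 2)), by positivity, fun x hx hx1 => ?_⟩
  have hpos : 0 < Real.arccos x := Real.arccos_pos.2 hx1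
  have h := hbθ (Real.arccos x) ⟨hpos, Real.arccos_le_pi x⟩
  rw [Real.cos_arccos hx hx1.le] at h
  refine le_trans ?_ h
  -- The bound `cos θ ≤ 1 - 2 θ² / π²` turns negative powers of `θ` into negative powers of `1 - cos
  -- θ`.
  have hq := Real.cos_le_one_sub_mul_cos_sq (x := Real.arccos x)
    (by rw [abs_of_pos hpos]; exact Real.arccos_le_pi x)
  rw [Real.cos_arccos hx hx1.le] at hq
  have hle : Real.arccos x ^ 2 ≤ Real.pi ^ 2 / 2 * (1 - x) := by
    have h1 : 2 / Real.pi ^ 2 * Real.arccos x ^ 2 ≤ 1 - x := by linarith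
    calc Real.arccos x ^ 2 = Real.pi ^ 2 / 2 * (2 / Real.pi ^ 2 * Real.arccos x ^ 2) := by
          field_simp
      _ ≤ _ := by gcongr
  rw [mul_assoc, ← Real.mul_rpow (by positivity) (by linarith)]
  gcongr
  calc _ ≤ (Real.arccos x ^ 2) ^ (-(((d : ℝ) - 1 + ν) / 2)) :=
        Real.rpow_le_rpow_of_nonpos (by positivity) hle (by linarith)
    _ = _ := by
        rw [← Real.rpow_natCast, ← Real.rpow_mul hpos.le]
        congr 1
        push_cast
        ring

theorem inner_sub_eq_cosTheta {d : ℕ} {v vs : Vel d} (h : v ≠ vs) (σ : Sph d) :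
    inner ℝ (σ : Vel d) (v - vs) = ‖v - vs‖ * cosTheta v vs σ := by
  have : ‖v - vs‖ ≠ 0 := norm_ne_zero_iff.2 (sub_ne_zero.2 h)
  rw [cosTheta, real_inner_comm]
  field_simp

theorem abs_cosTheta_le {d : ℕ} (v vs : Vel d) (σ : Sph d) : |cosTheta v vs σ| ≤ 1 := by
  rw [cosTheta, abs_div, abs_norm]
  refine div_le_one_of_le₀ ?_ (norm_nonneg _)
  simpa using abs_real_inner_le_norm (v - vs) (σ : Vel d)

/-- `|v' - v|² = |v - v_*|² (1 - cos θ) / 2`. -/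
theorem norm_vPrime_sub_sq {d : ℕ} (v vs : Vel d) (σ : Sph d) :
    ‖vPrime v vs σ - v‖ ^ 2 = ‖v - vs‖ ^ 2 * (1 - cosTheta v vs σ) / 2 := by
  rw [vPrime_eq, add_sub_cancel_left, norm_shift_sq (norm_sph σ)]
  by_cases h : v = vs
  · simp [h]
  · rw [inner_sub_eq_cosTheta h]
    ring

/-- A pointwise comparison with the collision weight away from the grazing set suffices to compare
weighted squared increments. -/
theorem mul_increment_sq_le {d : ℕ} {γ : ℝ} {b : ℝ → ℝ} {C g : ℝ} {p : Vel d × Vel d × Sph d}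
    (h : p.1 ≠ p.2.1 → cosTheta p.1 p.2.1 p.2.2 < 1 → g ≤ C * collWeight γ b p) (f : Vel d → ℝ) :
    g * increment f p ^ 2 ≤ C * (collWeight γ b p * increment f p ^ 2) := by
  -- Where `v' = v` the increment vanishes, so the value of the weight does not matter. This covers
  -- the diagonal and `cos θ = 1`, where `b` is not controlled.
  by_cases h0 : vPrime p.1 p.2.1 p.2.2 = p.1
  · simp [increment, h0]
  · have h1 : 0 < ‖p.1 - p.2.1‖ ^ 2 * (1 - cosTheta p.1 p.2.1 p.2.2) / 2 := by
      rw [← norm_vPrime_sub_sq]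
      have := norm_pos_iff.2 (sub_ne_zero.2 h0)
      positivity
    have h2 : p.1 ≠ p.2.1 := fun he => by simp [he] at h1
    have h3 : cosTheta p.1 p.2.1 p.2.2 < 1 := by
      have h4 : 0 < ‖p.1 - p.2.1‖ ^ 2 := by
        have := norm_pos_iff.2 (sub_ne_zero.2 h2)
        positivity
      have h5 := pos_of_mul_pos_right (show 0 < ‖p.1 - p.2.1‖ ^ 2 *
        (1 - cosTheta p.1 p.2.1 p.2.2) by linarith) h4.le
      linarith
    rw [← mul_assoc]
    exact mul_le_mul_of_nonneg_right (h h2 h3) (sq_nonneg _)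

theorem two_mul_dirichlet {d : ℕ} (γ : ℝ) (b : ℝ → ℝ) (f : Vel d → ℝ) :
    2 * dirichlet γ b f =
      ∫⁻ p, ENNReal.ofReal (collWeight γ b p * increment f p ^ 2) ∂(collMeasure d) := by
  rw [dirichlet, ← mul_assoc, one_div, ENNReal.mul_inv_cancel (by norm_num) (by norm_num), one_mul]

theorem lintegral_le_dirichlet {d : ℕ} {γ : ℝ} {b : ℝ → ℝ} {C : ℝ} (hC : 0 ≤ C)
    {g : Vel d × Vel d × Sph d → ℝ}
    (h : ∀ p : Vel d × Vel d × Sph d, p.1 ≠ p.2.1 → cosTheta p.1 p.2.1 p.2.2 < 1 →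
      g p ≤ C * collWeight γ b p) (f : Vel d → ℝ) :
    ∫⁻ p, ENNReal.ofReal (g p * increment f p ^ 2) ∂(collMeasure d) ≤
      ENNReal.ofReal (2 * C) * dirichlet γ b f := by
  have h2 : ENNReal.ofReal (2 * C) * dirichlet γ b f = ENNReal.ofReal C * (2 * dirichlet γ b f) := by
    rw [ENNReal.ofReal_mul (by norm_num), ENNReal.ofReal_ofNat]
    ring
  rw [h2, two_mul_dirichlet, ← lintegral_const_mul' _ _ ENNReal.ofReal_ne_top]
  refine lintegral_mono fun p => ?_
  rw [← ENNReal.ofReal_mul hC]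
  exact ENNReal.ofReal_le_ofReal (mul_increment_sq_le (h p) f)

/-! ### Poincaré inequality on a ball -/

theorem maxwellian_anti {d : ℕ} {v w : Vel d} (h : ‖v‖ ≤ ‖w‖) : maxwellian w ≤ maxwellian v := by
  unfold maxwellian
  gcongr

/-- Local Poincaré inequality. -/
theorem exists_local_poincare {d : ℕ} (hd : 2 ≤ d) {γ q c : ℝ} (hγ : γ < 0) (hq : 0 < q)
    (hc : 0 < c) {b : ℝ → ℝ} (hb : ∀ x, -1 ≤ x → x < 1 → c * (1 - x) ^ (-q) ≤ b x)
    {R : ℝ} (hR : 0 < R) :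
    ∃ C : ℝ, 0 < C ∧ ∀ f : Vel d → ℝ, Measurable f → ∃ m : ℝ,
      ∫⁻ v in Metric.ball 0 R, ENNReal.ofReal ((f v / maxwellian v - m) ^ 2) ≤
        ENNReal.ofReal C * dirichlet γ b f := by
  obtain ⟨c', hc', hball⟩ := exists_lintegral_ball_le hd
  -- Relative speeds below `4 R` produce the displacements of length below `2 R`, the diameter of
  -- the ball. For such collisions `v` and `v_*` have norm at most `5 R`, so `maxwellian e` bounds
  -- both Maxwellians below and `w` bounds the collision weight below.
  set e : Vel d := EuclideanSpace.single (⟨0, by omega⟩ : Fin d) (5 * R) with he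
  have hen : ‖e‖ = 5 * R := by simp [he, abs_of_pos hR]
  set w : ℝ := c * (4 * R) ^ γ * 2 ^ (-q) * (maxwellian e * maxwellian e) with hw
  have hwpos : 0 < w := by
    have := maxwellian_pos e
    positivity
  set V : ℝ := (volume (Metric.ball (0 : Vel d) R)).toReal with hV
  have hVtop : volume (Metric.ball (0 : Vel d) R) ≠ ⊤ := measure_ball_lt_top.ne
  have hV0 : volume (Metric.ball (0 : Vel d) R) ≠ 0 := (Metric.measure_ball_pos volume 0 hR).ne'
  have hVpos : 0 < V := ENNReal.toReal_pos hV0 hVtop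
  refine ⟨V⁻¹ * (c'⁻¹ * (2 * w⁻¹)), by positivity, fun f hf => ?_⟩
  set h : Vel d → ℝ := fun v => f v / maxwellian v with hh
  have hhm : Measurable h := hf.div continuous_maxwellian.measurable
  have hpair : ∫⁻ v in Metric.ball 0 R, ∫⁻ v' in Metric.ball 0 R, ENNReal.ofReal ((h v' - h v) ^ 2) ≤
      ENNReal.ofReal (c'⁻¹ * (2 * w⁻¹)) * dirichlet γ b f := by
    have hD := lintegral_le_dirichlet (γ := γ) (b := b) (C := w⁻¹) (by positivity)
      (g := fun p : Vel d × Vel d × Sph d => {p : Vel d × Vel d × Sph d | ‖p.1‖ < R ∧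
        ‖p.1 - p.2.1‖ < 4 * R}.indicator (fun _ => 1) p) ?_ f
    · rw [ENNReal.ofReal_mul (by positivity), mul_assoc]
      refine le_trans ?_ (mul_le_mul_right hD _)
      rw [lintegral_collMeasure_relative, ENNReal.ofReal_inv_of_pos hc']
      · rw [← ENNReal.mul_le_iff_le_inv (ENNReal.ofReal_pos.2 hc').ne' ENNReal.ofReal_ne_top,
          ← lintegral_const_mul' _ _ ENNReal.ofReal_ne_top]
        rw [← lintegral_indicator measurableSet_ball]
        refine lintegral_mono fun v => ?_
        by_cases hv : v ∈ Metric.ball (0 : Vel d) R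
        swap
        · rw [indicator_of_notMem hv]; exact bot_le
        rw [indicator_of_mem hv]
        rw [mem_ball_zero_iff] at hv
        calc ENNReal.ofReal c' * ∫⁻ v' in Metric.ball 0 R, ENNReal.ofReal ((h v' - h v) ^ 2)
            ≤ ENNReal.ofReal c' * ∫⁻ w in Metric.ball 0 (4 * R / 2),
                ENNReal.ofReal ((h (v + w) - h v) ^ 2) := by
              refine mul_le_mul' le_rfl ?_
              rw [← lintegral_indicator measurableSet_ball, ← lintegral_indicator measurableSet_ball,
                ← lintegral_add_left_eq_self (μ := volume) _ v]
              refine lintegral_mono fun w => ?_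
              by_cases hw : v + w ∈ Metric.ball (0 : Vel d) R
              swap
              · rw [indicator_of_notMem hw]; exact bot_le
              rw [indicator_of_mem hw, indicator_of_mem]
              rw [mem_ball_zero_iff] at hw ⊢
              have := norm_sub_le (v + w) v
              rw [add_sub_cancel_left] at this
              linarith
          _ ≤ ∫⁻ u in Metric.ball 0 (4 * R), ∫⁻ σ : Sph d,
                ENNReal.ofReal ((h (v + shift (σ : Vel d) u) - h v) ^ 2) ∂(surfaceMeasure d) := by
              refine hball (4 * R) (by positivity) (fun w => ENNReal.ofReal ((h (v + w) - h v) ^ 2)) ?_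
              have : Measurable fun w : Vel d => h (v + w) := hhm.comp (by fun_prop)
              exact ((this.sub_const _).pow_const 2).ennreal_ofReal
          _ ≤ _ := by
              rw [← lintegral_indicator measurableSet_ball]
              refine lintegral_mono fun u => ?_
              by_cases hu : u ∈ Metric.ball (0 : Vel d) (4 * R)
              swap
              · rw [indicator_of_notMem hu]; exact bot_le
              rw [indicator_of_mem hu]
              rw [mem_ball_zero_iff] at hu
              refine lintegral_mono fun σ => ?_
              rw [indicator_of_mem (by simpa using ⟨hv, hu⟩)]
              refine ENNReal.ofReal_le_ofReal (le_of_eq ?_)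
              rw [increment, vPrime_eq, sub_sub_cancel]
              simp only [hh]
              ring
      · refine Measurable.ennreal_ofReal (Measurable.mul ?_ (Measurable.pow_const ?_ 2))
        · refine measurable_const.indicator (MeasurableSet.inter
            (s₁ := {p : Vel d × Vel d × Sph d | ‖p.1‖ < R})
            (s₂ := {p : Vel d × Vel d × Sph d | ‖p.1 - p.2.1‖ < 4 * R}) ?_ ?_)
          · exact (isOpen_lt (by fun_prop) (by fun_prop)).measurableSet
          · exact (isOpen_lt (by fun_prop) (by fun_prop)).measurableSet
        · exact (hhm.comp measurable_fst).sub (hhm.comp measurable_vPrime)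
    · intro p hp hx
      have hρ : 0 < ‖p.1 - p.2.1‖ := norm_pos_iff.2 (sub_ne_zero.2 hp)
      have hx1 := (abs_le.1 (abs_cosTheta_le p.1 p.2.1 p.2.2)).1
      have hbx := hb _ hx1 hx
      have hb0 : 0 ≤ b (cosTheta p.1 p.2.1 p.2.2) :=
        le_trans (mul_nonneg hc.le (Real.rpow_nonneg (by linarith) _)) hbx
      have hM1 := maxwellian_pos p.1
      have hM2 := maxwellian_pos p.2.1
      by_cases hs : p ∈ {p : Vel d × Vel d × Sph d | ‖p.1‖ < R ∧ ‖p.1 - p.2.1‖ < 4 * R}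
      swap
      · simp only [indicator_of_notMem hs, collWeight, kernelB]
        positivity
      simp only [indicator_of_mem hs]
      obtain ⟨h1, h2⟩ := hs
      rw [inv_mul_eq_div, le_div_iff₀ hwpos, one_mul, hw, collWeight, kernelB]
      have h3 : ‖p.2.1‖ ≤ 5 * R := by
        have := norm_sub_le p.1 (p.1 - p.2.1)
        rw [sub_sub_cancel] at this
        linarith
      have h4 : maxwellian e ≤ maxwellian p.1 := maxwellian_anti (by rw [hen]; linarith)
      have h5 : maxwellian e ≤ maxwellian p.2.1 := maxwellian_anti (by rw [hen]; linarith)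
      have h6 : (4 * R) ^ γ ≤ ‖p.1 - p.2.1‖ ^ γ := Real.rpow_le_rpow_of_nonpos hρ h2.le hγ.le
      have h7 : (2 : ℝ) ^ (-q) ≤ (1 - cosTheta p.1 p.2.1 p.2.2) ^ (-q) :=
        Real.rpow_le_rpow_of_nonpos (by linarith) (by linarith) (by linarith)
      have hMe := maxwellian_pos e
      calc _ = (4 * R) ^ γ * (c * 2 ^ (-q)) * maxwellian e * maxwellian e := by ring
        _ ≤ ‖p.1 - p.2.1‖ ^ γ * (c * (1 - cosTheta p.1 p.2.1 p.2.2) ^ (-q)) * maxwellian p.1 *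
            maxwellian p.2.1 := by gcongr
        _ ≤ _ := by gcongr
  have hm2 : Measurable fun p : Vel d × Vel d => ENNReal.ofReal ((h p.2 - h p.1) ^ 2) :=
    (((hhm.comp measurable_snd).sub (hhm.comp measurable_fst)).pow_const 2).ennreal_ofReal
  -- The constant `m` is the value of `h` at a point where the inner integral does not exceed its
  -- average over the ball.
  obtain ⟨v0, -, hv0⟩ := exists_le_setLAverage hV0 hVtop (f := fun v => ∫⁻ v' in Metric.ball 0 R,
    ENNReal.ofReal ((h v' - h v) ^ 2)) (hm2.lintegral_prod_right').aemeasurable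
  refine ⟨h v0, hv0.trans ?_⟩
  rw [setLAverage_eq, ENNReal.ofReal_mul (by positivity), mul_assoc, ENNReal.div_eq_inv_mul,
    ENNReal.ofReal_inv_of_pos hVpos, hV, ENNReal.ofReal_toReal hVtop]
  gcongr

/-! ### Gaussian moments and comparison of weights -/

theorem integrable_exp_neg_mul_norm_sq {d : ℕ} {c : ℝ} (hc : 0 < c) :
    Integrable fun v : Vel d => Real.exp (-c * ‖v‖ ^ 2) := by
  by_contra h
  have h1 := integral_undef h
  rw [GaussianFourier.integral_rexp_neg_mul_sq_norm hc] at h1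
  have : 0 < (Real.pi / c) ^ (Module.finrank ℝ (Vel d) / 2 : ℝ) := by positivity
  exact this.ne' h1

/-- Polynomially weighted Gaussian moments are finite. -/
theorem lintegral_moment_lt_top {d : ℕ} {p : ℝ} (hp : 0 ≤ p) :
    ∫⁻ v : Vel d, ENNReal.ofReal ((2 * (1 + ‖v‖)) ^ p * (maxwellian v *
      Real.exp (3 / 8 * ‖v‖ ^ 2))) < ⊤ := by
  -- The polynomial is bounded by `exp (4 p² + |v|² / 16)` up to a constant, and the exponents add
  -- up to `-1/2 + 3/8 + 1/16 = -1/16`.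
  have hi := (integrable_exp_neg_mul_norm_sq (d := d) (c := 1 / 16) (by norm_num)).const_mul
    (2 ^ p * Real.exp (4 * p ^ 2) * (1 / (2 * Real.pi) ^ ((d : ℝ) / 2)))
  refine lt_of_le_of_lt (lintegral_mono fun v => ENNReal.ofReal_le_ofReal ?_) hi.lintegral_lt_top
  have h1 : (2 * (1 + ‖v‖)) ^ p ≤ 2 ^ p * Real.exp (4 * p ^ 2 + ‖v‖ ^ 2 / 16) := by
    rw [Real.mul_rpow (by norm_num) (by positivity)]
    gcongr
    calc (1 + ‖v‖) ^ p ≤ Real.exp ‖v‖ ^ p := by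
          gcongr
          rw [add_comm]
          exact Real.add_one_le_exp _
      _ = Real.exp (‖v‖ * p) := by rw [Real.exp_mul]
      _ ≤ _ := by
          gcongr
          nlinarith [sq_nonneg (‖v‖ / 4 - 2 * p)]
  calc _ ≤ 2 ^ p * Real.exp (4 * p ^ 2 + ‖v‖ ^ 2 / 16) *
        (maxwellian v * Real.exp (3 / 8 * ‖v‖ ^ 2)) := by
        have := maxwellian_pos v
        gcongr
    _ = _ := by
        rw [maxwellian, show -(1 / 16) * ‖v‖ ^ 2 = ‖v‖ ^ 2 / 16 + (-‖v‖ ^ 2 / 2 + 3 / 8 * ‖v‖ ^ 2) by ring,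
          Real.exp_add, Real.exp_add, Real.exp_add]
        ring

theorem one_le_bracket {d : ℕ} (v : Vel d) : 1 ≤ bracket v := by
  rw [bracket]
  exact Real.one_le_sqrt.2 (by nlinarith [sq_nonneg ‖v‖])

theorem bracket_le {d : ℕ} (v : Vel d) : bracket v ≤ 1 + ‖v‖ := by
  rw [bracket, Real.sqrt_le_left (by positivity)]
  nlinarith [norm_nonneg v]

theorem norm_le_bracket {d : ℕ} (v : Vel d) : ‖v‖ ≤ bracket v := by
  rw [bracket]
  exact Real.le_sqrt_of_sq_le (by linarith)

theorem continuous_bracket {d : ℕ} : Continuous (bracket : Vel d → ℝ) := by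
  unfold bracket
  fun_prop

theorem measurable_bracket_rpow {d : ℕ} (s : ℝ) : Measurable fun v : Vel d => bracket v ^ s :=
  continuous_bracket.measurable.pow_const s

theorem rpow_le_of_comparable {x y L : ℝ} (hx : 0 < x) (hy : 0 < y) (hL : 1 ≤ L) (hxy : x ≤ L * y)
    (hyx : y ≤ L * x) (s : ℝ) : x ^ s ≤ L ^ |s| * y ^ s := by
  rcases le_total 0 s with hs | hs
  · rw [abs_of_nonneg hs, ← Real.mul_rpow (by linarith) hy.le]
    exact Real.rpow_le_rpow hx.le hxy hs
  · rw [abs_of_nonpos hs, Real.rpow_neg (by linarith), ← Real.inv_rpow (by linarith),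
      ← Real.mul_rpow (by positivity) hy.le]
    refine Real.rpow_le_rpow_of_nonpos (by positivity) ?_ hs
    rw [inv_mul_eq_div, div_le_iff₀ (by linarith)]
    linarith

/-- A Peetre-type comparison: trading `|v - v_*|` for `⟨v⟩` costs only a power of `1 + |v_*|`, which
the Maxwellian in `v_*` absorbs. -/
theorem norm_sub_rpow_le {d : ℕ} {v vs : Vel d} (h : 1 ≤ ‖v - vs‖) (s : ℝ) :
    ‖v - vs‖ ^ s ≤ (2 * (1 + ‖vs‖)) ^ |s| * bracket v ^ s ∧
      bracket v ^ s ≤ (2 * (1 + ‖vs‖)) ^ |s| * ‖v - vs‖ ^ s := by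
  have h1 : ‖v - vs‖ ≤ 2 * (1 + ‖vs‖) * bracket v := by
    nlinarith [norm_sub_le v vs, norm_le_bracket v, one_le_bracket v, norm_nonneg vs]
  have h2 : bracket v ≤ 2 * (1 + ‖vs‖) * ‖v - vs‖ := by
    have h3 := norm_add_le (v - vs) vs
    rw [sub_add_cancel] at h3
    nlinarith [bracket_le v, norm_nonneg vs]
  have hv := one_le_bracket v
  have hs := norm_nonneg vs
  exact ⟨rpow_le_of_comparable (by linarith) (by linarith) (by linarith) h1 h2 s,
    rpow_le_of_comparable (by linarith) (by linarith) (by linarith) h2 h1 s⟩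

theorem bracket_rpow_le {d : ℕ} (v : Vel d) (s : ℝ) : bracket v ^ s ≤ (2 * (1 + ‖v‖)) ^ |s| := by
  have h := rpow_le_of_comparable (x := bracket v) (y := 1) (L := 2 * (1 + ‖v‖))
    (by linarith [one_le_bracket v]) one_pos (by linarith [norm_nonneg v])
    (by linarith [bracket_le v, norm_nonneg v])
    (by nlinarith [one_le_bracket v, norm_nonneg v]) s
  simpa using h

/-! ### Collisions with displacement of fixed size -/

/-- A kernel that only keeps the collisions with `a² ≤ 2 |v' - v|² ≤ 16 a²`. -/
noncomputable def subKernel (d : ℕ) (s a : ℝ) : ℝ × ℝ → ℝ :=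
  {p : ℝ × ℝ | a ^ 2 ≤ p.1 ^ 2 * (1 - p.2) ∧ p.1 ^ 2 * (1 - p.2) ≤ 16 * a ^ 2}.indicator
    fun p => p.1 ^ s * (p.1 / a) ^ (d - 1)

theorem measurableSet_window (a : ℝ) : MeasurableSet
    {p : ℝ × ℝ | a ^ 2 ≤ p.1 ^ 2 * (1 - p.2) ∧ p.1 ^ 2 * (1 - p.2) ≤ 16 * a ^ 2} := by
  refine MeasurableSet.inter (s₁ := {p : ℝ × ℝ | a ^ 2 ≤ p.1 ^ 2 * (1 - p.2)})
    (s₂ := {p : ℝ × ℝ | p.1 ^ 2 * (1 - p.2) ≤ 16 * a ^ 2}) ?_ ?_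
  · exact (isClosed_le (by fun_prop) (by fun_prop)).measurableSet
  · exact (isClosed_le (by fun_prop) (by fun_prop)).measurableSet

theorem measurable_subKernel (d : ℕ) (s a : ℝ) : Measurable (subKernel d s a) :=
  Measurable.indicator (by fun_prop) (measurableSet_window a)

/-- On the window `1 - x ≤ 16 a² / ρ²`, so the singularity of `b` yields at least a constant times
`ρ^(d-1+ν)`. Together with `ρ^γ` this is `ρ^(γ+ν) ρ^(d-1)`. -/
theorem subKernel_le {d : ℕ} (hd : 2 ≤ d) {γ ν c a ρ x : ℝ} {b : ℝ → ℝ} (hν : 0 < ν) (hc : 0 < c)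
    (ha : 0 < a)
    (hb : ∀ x, -1 ≤ x → x < 1 → c * (1 - x) ^ (-(((d : ℝ) - 1 + ν) / 2)) ≤ b x)
    (hρ : 0 < ρ) (hx : -1 ≤ x) (hx1 : x < 1) :
    subKernel d (γ + ν) a (ρ, x) ≤
      (a ^ (d - 1))⁻¹ * (c * (16 * a ^ 2) ^ (-(((d : ℝ) - 1 + ν) / 2)))⁻¹ * (ρ ^ γ * b x) := by
  have hd' : (2 : ℝ) ≤ d := by exact_mod_cast hd
  have hbx := hb x hx hx1
  set q := ((d : ℝ) - 1 + ν) / 2 with hq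
  have hb0 : 0 ≤ b x := le_trans (mul_nonneg hc.le (Real.rpow_nonneg (by linarith) _)) hbx
  by_cases hw : (ρ, x) ∈ {p : ℝ × ℝ | a ^ 2 ≤ p.1 ^ 2 * (1 - p.2) ∧ p.1 ^ 2 * (1 - p.2) ≤ 16 * a ^ 2}
  swap
  · rw [subKernel, indicator_of_notMem hw]
    positivity
  rw [subKernel, indicator_of_mem hw]
  have h1 : (ρ ^ 2)⁻¹ ^ (-q) * (16 * a ^ 2) ^ (-q) ≤ (1 - x) ^ (-q) := by
    rw [← Real.mul_rpow (by positivity) (by positivity)]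
    refine Real.rpow_le_rpow_of_nonpos (by linarith) ?_ (by rw [hq]; linarith)
    rw [inv_mul_eq_div, le_div_iff₀ (by positivity)]
    linarith [hw.2]
  have h2 : (ρ ^ 2)⁻¹ ^ (-q) = ρ ^ (d - 1) * ρ ^ ν := by
    rw [Real.inv_rpow (by positivity), Real.rpow_neg (by positivity), inv_inv, ← Real.rpow_natCast,
      ← Real.rpow_natCast, ← Real.rpow_mul hρ.le, ← Real.rpow_add hρ]
    congr 1
    rw [Nat.cast_sub (by omega), hq]
    push_cast
    ring
  rw [h2] at h1
  set w := (16 * a ^ 2) ^ (-q) with hw'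
  have hwpos : 0 < w := by positivity
  calc (ρ ^ (γ + ν) * (ρ / a) ^ (d - 1)) =
        (a ^ (d - 1))⁻¹ * (c * w)⁻¹ * (ρ ^ γ * (c * (ρ ^ (d - 1) * ρ ^ ν * w))) := by
        rw [Real.rpow_add hρ, div_pow]
        field_simp
    _ ≤ (a ^ (d - 1))⁻¹ * (c * w)⁻¹ * (ρ ^ γ * (c * (1 - x) ^ (-q))) := by gcongr
    _ ≤ _ := by gcongr

theorem cosTheta_eq_inner {d : ℕ} (v vs : Vel d) (σ : Sph d) :
    cosTheta v vs σ = inner ℝ (‖v - vs‖⁻¹ • (v - vs)) (σ : Vel d) := by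
  rw [cosTheta, inner_smul_left, div_eq_inv_mul]
  simp

theorem subKernel_nonneg {d : ℕ} {s a ρ x : ℝ} (ha : 0 < a) (hρ : 0 ≤ ρ) :
    0 ≤ subKernel d s a (ρ, x) := by
  refine indicator_apply_nonneg fun _ => ?_
  change 0 ≤ ρ ^ s * (ρ / a) ^ (d - 1)
  positivity

/-- For a given relative velocity the kernel is constant on an annulus of opening `a / ρ` and zero
elsewhere. Its factor `(ρ / a)^(d-1)` is there to compensate the surface of this annulus. -/
theorem lintegral_subKernel_eq {d : ℕ} (s : ℝ) {a : ℝ} {v vs : Vel d} (h : v ≠ vs) :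
    ∫⁻ σ, ENNReal.ofReal (subKernel d s a (‖v - vs‖, cosTheta v vs σ)) ∂(surfaceMeasure d) =
      ENNReal.ofReal (‖v - vs‖ ^ s * (‖v - vs‖ / a) ^ (d - 1)) *
        surfaceMeasure d {σ : Sph d | (a / ‖v - vs‖) ^ 2 ≤
            1 - inner ℝ (‖v - vs‖⁻¹ • (v - vs)) (σ : Vel d) ∧
          1 - inner ℝ (‖v - vs‖⁻¹ • (v - vs)) (σ : Vel d) ≤ 16 * (a / ‖v - vs‖) ^ 2} := by
  have hρ : 0 < ‖v - vs‖ := norm_pos_iff.2 (sub_ne_zero.2 h)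
  rw [← lintegral_indicator_const (measurableSet_cap _ _ _)]
  refine lintegral_congr fun σ => ?_
  rw [subKernel]
  have hiff : (‖v - vs‖, cosTheta v vs σ) ∈ {p : ℝ × ℝ | a ^ 2 ≤ p.1 ^ 2 * (1 - p.2) ∧
      p.1 ^ 2 * (1 - p.2) ≤ 16 * a ^ 2} ↔ σ ∈ {σ : Sph d | (a / ‖v - vs‖) ^ 2 ≤
            1 - inner ℝ (‖v - vs‖⁻¹ • (v - vs)) (σ : Vel d) ∧
          1 - inner ℝ (‖v - vs‖⁻¹ • (v - vs)) (σ : Vel d) ≤ 16 * (a / ‖v - vs‖) ^ 2} := by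
    simp only [mem_ofPred_eq, ← cosTheta_eq_inner]
    rw [div_pow, div_le_iff₀ (by positivity), mul_div_assoc', le_div_iff₀ (by positivity),
      mul_comm (‖v - vs‖ ^ 2)]
  by_cases hw : σ ∈ {σ : Sph d | (a / ‖v - vs‖) ^ 2 ≤
            1 - inner ℝ (‖v - vs‖⁻¹ • (v - vs)) (σ : Vel d) ∧
          1 - inner ℝ (‖v - vs‖⁻¹ • (v - vs)) (σ : Vel d) ≤ 16 * (a / ‖v - vs‖) ^ 2}
  · rw [indicator_of_mem (hiff.2 hw), indicator_of_mem hw]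
  · rw [indicator_of_notMem (fun h' => hw (hiff.1 h')), indicator_of_notMem hw, ENNReal.ofReal_zero]

/-- Total cross section of the kernel `subKernel`. -/
theorem exists_lintegral_subKernel {d : ℕ} (hd : 2 ≤ d) (s : ℝ) : ∃ c C : ℝ, 0 < c ∧ 0 < C ∧
    ∀ a : ℝ, 2 ≤ a → ∀ v vs : Vel d,
      (∫⁻ σ, ENNReal.ofReal (subKernel d s a (‖v - vs‖, cosTheta v vs σ)) ∂(surfaceMeasure d) ≤
        ENNReal.ofReal (C * ((2 * (1 + ‖vs‖)) ^ |s| * bracket v ^ s))) ∧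
      (6 * a + 1 ≤ ‖v‖ → ‖vs‖ ≤ 1 → ENNReal.ofReal (c * bracket v ^ s) ≤
        ∫⁻ σ, ENNReal.ofReal (subKernel d s a (‖v - vs‖, cosTheta v vs σ)) ∂(surfaceMeasure d)) := by
  obtain ⟨c, hc, hlow⟩ := exists_le_annulus hd
  obtain ⟨C, hC, hup⟩ := exists_cap_le hd
  -- The power of `4` in the lower constant is `2 (1 + |v_*|)` for `|v_*| ≤ 1`. The one in the upper
  -- constant comes from the outer opening `4 a / ρ` of the annulus.
  refine ⟨c * (4 ^ |s|)⁻¹, C * 4 ^ (d - 1), by positivity, by positivity, fun a ha v vs => ?_⟩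
  have hapos : 0 < a := by linarith
  have hbr : 0 < bracket v := by linarith [one_le_bracket v]
  have hω : v ≠ vs → ‖‖v - vs‖⁻¹ • (v - vs)‖ = 1 := fun h => by
    rw [norm_smul, norm_inv, norm_norm, inv_mul_cancel₀ (norm_ne_zero_iff.2 (sub_ne_zero.2 h))]
  constructor
  · by_cases hρ1 : 1 ≤ ‖v - vs‖
    · have hne : v ≠ vs := fun h => by norm_num [h] at hρ1
      have hρ : 0 < ‖v - vs‖ := by linarith
      rw [lintegral_subKernel_eq s hne]
      have h1 := hup _ (hω hne) ((a / ‖v - vs‖) ^ 2) (4 * (a / ‖v - vs‖)) (by positivity)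
      rw [show (4 * (a / ‖v - vs‖)) ^ 2 = 16 * (a / ‖v - vs‖) ^ 2 by ring] at h1
      refine (mul_le_mul' le_rfl h1).trans ?_
      rw [← ENNReal.ofReal_mul (by positivity)]
      refine ENNReal.ofReal_le_ofReal ?_
      calc _ = C * 4 ^ (d - 1) * ‖v - vs‖ ^ s * (‖v - vs‖ / a * (a / ‖v - vs‖)) ^ (d - 1) := by
            rw [mul_pow, mul_pow]; ring
        _ = C * 4 ^ (d - 1) * ‖v - vs‖ ^ s := by
            rw [div_mul_div_cancel₀ hapos.ne', div_self hρ.ne', one_pow, mul_one]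
        _ ≤ _ := by
            refine mul_le_mul_of_nonneg_left (norm_sub_rpow_le hρ1 s).1 (by positivity)
    -- Relative speeds below `1` give `ρ² (1 - cos θ) ≤ 2 < a²`, so the window is empty.
    · refine le_trans (le_of_eq ?_) bot_le
      refine (lintegral_congr fun σ => ?_).trans lintegral_zero
      have : (‖v - vs‖, cosTheta v vs σ) ∉ {p : ℝ × ℝ | a ^ 2 ≤ p.1 ^ 2 * (1 - p.2) ∧
          p.1 ^ 2 * (1 - p.2) ≤ 16 * a ^ 2} := by
        rintro ⟨h1, -⟩
        have h2 := abs_le.1 (abs_cosTheta_le v vs σ)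
        have h3 : ‖v - vs‖ ^ 2 ≤ 1 := by nlinarith [norm_nonneg (v - vs)]
        simp only at h1
        nlinarith [sq_nonneg ‖v - vs‖]
      rw [subKernel, indicator_of_notMem this, ENNReal.ofReal_zero]
  · intro hv hvs
    -- This makes the opening `a / ρ` at most `1/6`, as the lower bound for annuli requires.
    have hρ6 : 6 * a ≤ ‖v - vs‖ := by linarith [norm_sub_norm_le v vs]
    have hρ : 0 < ‖v - vs‖ := by linarith
    have hne : v ≠ vs := sub_ne_zero.1 (norm_pos_iff.1 hρ)
    rw [lintegral_subKernel_eq s hne]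
    have h1 := hlow _ (hω hne) (a / ‖v - vs‖) (by positivity) (by
      rw [div_le_iff₀ hρ]; linarith)
    refine le_trans ?_ (mul_le_mul' le_rfl h1)
    rw [← ENNReal.ofReal_mul (by positivity)]
    refine ENNReal.ofReal_le_ofReal ?_
    calc c * (4 ^ |s|)⁻¹ * bracket v ^ s ≤ c * (4 ^ |s|)⁻¹ * (4 ^ |s| * ‖v - vs‖ ^ s) := by
          gcongr
          refine (norm_sub_rpow_le (by linarith) s).2.trans ?_
          gcongr
          linarith
      _ = c * ‖v - vs‖ ^ s := by field_simp
      _ = c * ‖v - vs‖ ^ s * (‖v - vs‖ / a * (a / ‖v - vs‖)) ^ (d - 1) := by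
          rw [div_mul_div_cancel₀ hapos.ne', div_self hρ.ne', one_pow, mul_one]
      _ = _ := by rw [mul_pow]; ring

/-! ### Energy exchange and the Lyapunov estimate -/

/-- Follows from `(v - v_*) · (v' - v) = -|v' - v|²`: once `v' - v` is given, `v` enters the energy
gain only through `v_*`. A large displacement therefore loses energy unless `v_*` is large, however
large `v` is. -/
theorem norm_vPrime_sq_sub {d : ℕ} (v vs : Vel d) (σ : Sph d) :
    ‖vPrime v vs σ‖ ^ 2 - ‖v‖ ^ 2 =
      2 * inner ℝ vs (vPrime v vs σ - v) - ‖vPrime v vs σ - v‖ ^ 2 := by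
  have h1 : ‖vPrime v vs σ‖ ^ 2 = ‖v‖ ^ 2 + 2 * inner ℝ v (vPrime v vs σ - v) +
      ‖vPrime v vs σ - v‖ ^ 2 := by
    rw [← norm_add_sq_real, add_sub_cancel]
  have h2 : inner ℝ (v - vs) (vPrime v vs σ - v) = -‖vPrime v vs σ - v‖ ^ 2 := by
    have h3 : v - vs = ‖v - vs‖ • (σ : Vel d) - (2 : ℝ) • (vPrime v vs σ - v) := by
      rw [vPrime_eq, add_sub_cancel_left, shift]; module
    have h4 : ‖vPrime v vs σ - v‖ ^ 2 = ‖v - vs‖ * inner ℝ (σ : Vel d) (vPrime v vs σ - v) := by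
      rw [vPrime_eq, add_sub_cancel_left, norm_shift_sq (norm_sph σ), inner_shift (norm_sph σ)]; ring
    conv_lhs => rw [h3]
    rw [inner_sub_left, inner_smul_left, inner_smul_left, real_inner_self_eq_norm_sq, h4]
    simp only [conj_trivial]
    rw [← h4]
    ring
  rw [inner_sub_left] at h2
  linarith

/-- On the support of `subKernel` the energy gain is very negative, up to the energy of `v_*`. -/
theorem energy_gain_le {d : ℕ} {a : ℝ} {v vs : Vel d} {σ : Sph d}
    (h : a ^ 2 ≤ ‖v - vs‖ ^ 2 * (1 - cosTheta v vs σ)) :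
    (‖vPrime v vs σ‖ ^ 2 - ‖v‖ ^ 2) / 4 ≤ 3 / 8 * ‖vs‖ ^ 2 - a ^ 2 / 24 := by
  rw [norm_vPrime_sq_sub]
  have h1 := real_inner_le_norm vs (vPrime v vs σ - v)
  have h2 := norm_vPrime_sub_sq v vs σ
  -- The weights in Young's inequality keep the coefficient `3/8` of `|v_*|²` below the `1/2` of the
  -- Maxwellian and leave `-|v' - v|² / 12 ≤ -a² / 24`.
  nlinarith [sq_nonneg (3 * ‖vs‖ - 2 * ‖vPrime v vs σ - v‖)]

theorem measurable_sub_weight {d : ℕ} (s a : ℝ) : Measurable fun p : Vel d × Vel d × Sph d =>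
    ENNReal.ofReal (subKernel d s a (‖p.1 - p.2.1‖, cosTheta p.1 p.2.1 p.2.2)) *
      ENNReal.ofReal (maxwellian p.1 * maxwellian p.2.1) := by
  refine Measurable.mul (Measurable.ennreal_ofReal ((measurable_subKernel d s a).comp
    (Measurable.prodMk (by fun_prop) measurable_cosTheta))) ?_
  exact (Continuous.measurable ((continuous_maxwellian.comp (by fun_prop)).mul
    (continuous_maxwellian.comp (by fun_prop)))).ennreal_ofReal

/-- This is the nonnegativity of `(x e^(t/2) - y e^(-t/2))²`. -/
theorem sq_add_sq_le_sq_sub_add (x y t : ℝ) :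
    x ^ 2 + y ^ 2 ≤ (x - y) ^ 2 + (x ^ 2 * Real.exp t + y ^ 2 * Real.exp (-t)) := by
  have h1 : Real.exp t = Real.exp (t / 2) ^ 2 := by
    rw [← Real.exp_nat_mul]; congr 1; push_cast; ring
  have h2 : Real.exp (-t) = Real.exp (-(t / 2)) ^ 2 := by
    rw [← Real.exp_nat_mul]; congr 1; push_cast; ring
  have h3 : Real.exp (t / 2) * Real.exp (-(t / 2)) = 1 := by
    rw [← Real.exp_add]; simp
  rw [h1, h2]
  nlinarith [sq_nonneg (x * Real.exp (t / 2) - y * Real.exp (-(t / 2)))]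

/-- The energy inequality with the Lyapunov function `exp (|v|² / 4)`. -/
theorem two_mul_lintegral_le {d : ℕ} (hd : 2 ≤ d) (s a : ℝ) {h : Vel d → ℝ} (hh : Measurable h) :
    2 * ∫⁻ p : Vel d × Vel d × Sph d,
        ENNReal.ofReal (subKernel d s a (‖p.1 - p.2.1‖, cosTheta p.1 p.2.1 p.2.2)) *
          ENNReal.ofReal (maxwellian p.1 * maxwellian p.2.1) * ENNReal.ofReal (h p.1 ^ 2)
          ∂(collMeasure d) ≤
      ∫⁻ p : Vel d × Vel d × Sph d,
        ENNReal.ofReal (subKernel d s a (‖p.1 - p.2.1‖, cosTheta p.1 p.2.1 p.2.2)) *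
          ENNReal.ofReal (maxwellian p.1 * maxwellian p.2.1) *
          ENNReal.ofReal ((h p.1 - h (vPrime p.1 p.2.1 p.2.2)) ^ 2) ∂(collMeasure d) +
      2 * ∫⁻ p : Vel d × Vel d × Sph d,
        ENNReal.ofReal (subKernel d s a (‖p.1 - p.2.1‖, cosTheta p.1 p.2.1 p.2.2)) *
          ENNReal.ofReal (maxwellian p.1 * maxwellian p.2.1) *
          ENNReal.ofReal (h p.1 ^ 2 *
            Real.exp ((‖vPrime p.1 p.2.1 p.2.2‖ ^ 2 - ‖p.1‖ ^ 2) / 4)) ∂(collMeasure d) := by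
  have hk : Measurable fun p => ENNReal.ofReal (subKernel d s a p) :=
    (measurable_subKernel d s a).ennreal_ofReal
  have hK := measurable_sub_weight (d := d) s a
  have hH1 : Measurable fun q : Vel d × Vel d => ENNReal.ofReal (h q.1 ^ 2 *
      Real.exp ((‖q.2‖ ^ 2 - ‖q.1‖ ^ 2) / 4)) :=
    (((hh.comp measurable_fst).pow_const 2).mul (by fun_prop)).ennreal_ofReal
  have hH2 : Measurable fun q : Vel d × Vel d => ENNReal.ofReal (h q.1 ^ 2) :=
    ((hh.comp measurable_fst).pow_const 2).ennreal_ofReal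
  have e1 := lintegral_swap_collision hd hk hH1
  have e2 := lintegral_swap_collision hd hk hH2
  have m1 := hK.mul (hH1.comp (measurable_vPrime.prodMk measurable_fst))
  have m1' := hK.mul (hH1.comp (measurable_fst.prodMk measurable_vPrime))
  have m2' := hK.mul (hH2.comp (measurable_fst.prodMk measurable_vPrime))
  rw [two_mul, two_mul]
  -- One of the two copies on each side is replaced by its mirror image under the exchange of `v`
  -- and `v'`. What remains is a pointwise inequality.
  conv_lhs => arg 2; rw [← e2]
  conv_rhs => arg 2; arg 2; rw [← e1]
  have a1 := lintegral_add_left (μ := collMeasure d) m2' (fun p : Vel d × Vel d × Sph d =>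
    ENNReal.ofReal (subKernel d s a (‖p.1 - p.2.1‖, cosTheta p.1 p.2.1 p.2.2)) *
          ENNReal.ofReal (maxwellian p.1 * maxwellian p.2.1) *
          ENNReal.ofReal (h (vPrime p.1 p.2.1 p.2.2) ^ 2))
  have a2 := lintegral_add_left (μ := collMeasure d) m1' (fun p : Vel d × Vel d × Sph d =>
    ENNReal.ofReal (subKernel d s a (‖p.1 - p.2.1‖, cosTheta p.1 p.2.1 p.2.2)) *
          ENNReal.ofReal (maxwellian p.1 * maxwellian p.2.1) *
          ENNReal.ofReal (h (vPrime p.1 p.2.1 p.2.2) ^ 2 *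
            Real.exp ((‖p.1‖ ^ 2 - ‖vPrime p.1 p.2.1 p.2.2‖ ^ 2) / 4)))
  have a3 := lintegral_add_right (μ := collMeasure d) (fun p : Vel d × Vel d × Sph d =>
    ENNReal.ofReal (subKernel d s a (‖p.1 - p.2.1‖, cosTheta p.1 p.2.1 p.2.2)) *
          ENNReal.ofReal (maxwellian p.1 * maxwellian p.2.1) *
          ENNReal.ofReal ((h p.1 - h (vPrime p.1 p.2.1 p.2.2)) ^ 2)) (m1'.add m1)
  refine a1.symm.le.trans (le_trans ?_ (a3.trans (congrArg _ a2)).le)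
  refine lintegral_mono fun p => ?_
  simp only [Pi.mul_apply, Pi.add_apply, Function.comp]
  rw [← mul_add, ← mul_add, ← mul_add]
  refine mul_le_mul' le_rfl ?_
  rw [← ENNReal.ofReal_add (by positivity) (by positivity),
    ← ENNReal.ofReal_add (by positivity) (by positivity),
    ← ENNReal.ofReal_add (by positivity) (by positivity)]
  refine ENNReal.ofReal_le_ofReal ?_
  have := sq_add_sq_le_sq_sub_add (h p.1) (h (vPrime p.1 p.2.1 p.2.2))
    ((‖vPrime p.1 p.2.1 p.2.2‖ ^ 2 - ‖p.1‖ ^ 2) / 4)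
  rwa [← neg_div, neg_sub] at this

/-- Control of the weighted norm outside a ball. -/
theorem exists_lyapunov_bound {d : ℕ} (hd : 2 ≤ d) (s : ℝ) : ∃ a κ R : ℝ, 0 < a ∧ 0 < κ ∧ 0 < R ∧
    ∀ h : Vel d → ℝ, Measurable h → (∃ N, ∀ v, |h v| ≤ N) →
      ENNReal.ofReal κ * ∫⁻ v in (Metric.ball 0 R)ᶜ,
          ENNReal.ofReal (maxwellian v * h v ^ 2 * bracket v ^ s) ≤
        ∫⁻ p : Vel d × Vel d × Sph d,
          ENNReal.ofReal (subKernel d s a (‖p.1 - p.2.1‖, cosTheta p.1 p.2.1 p.2.2)) *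
            ENNReal.ofReal (maxwellian p.1 * maxwellian p.2.1) *
            ENNReal.ofReal ((h p.1 - h (vPrime p.1 p.2.1 p.2.2)) ^ 2) ∂(collMeasure d) +
        ENNReal.ofReal κ * ∫⁻ v in Metric.ball 0 R,
          ENNReal.ofReal (maxwellian v * h v ^ 2 * bracket v ^ s) := by
  obtain ⟨c, C, hc, hC, hker⟩ := exists_lintegral_subKernel hd s
  have hZfin := lintegral_moment_lt_top (d := d) (abs_nonneg s)
  set Z := ∫⁻ v : Vel d, ENNReal.ofReal ((2 * (1 + ‖v‖)) ^ |s| * (maxwellian v *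
      Real.exp (3 / 8 * ‖v‖ ^ 2))) with hZ
  have hMm : Measurable fun v : Vel d => ENNReal.ofReal (maxwellian v) :=
    continuous_maxwellian.measurable.ennreal_ofReal
  set z := ∫⁻ v in Metric.closedBall (0 : Vel d) 1, ENNReal.ofReal (maxwellian v) with hz
  have hZ1 : ∀ v : Vel d, maxwellian v ≤ (2 * (1 + ‖v‖)) ^ |s| * (maxwellian v *
      Real.exp (3 / 8 * ‖v‖ ^ 2)) := fun v => by
    have h1 : (1 : ℝ) ≤ (2 * (1 + ‖v‖)) ^ |s| :=
      Real.one_le_rpow (by linarith [norm_nonneg v]) (abs_nonneg s)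
    have h2 : 1 ≤ Real.exp (3 / 8 * ‖v‖ ^ 2) := Real.one_le_exp (by positivity)
    have h3 := maxwellian_pos v
    calc maxwellian v = 1 * (maxwellian v * 1) := by ring
      _ ≤ _ := by gcongr
  have hzfin : z < ⊤ := by
    refine lt_of_le_of_lt ?_ hZfin
    refine (setLIntegral_le_lintegral _ _).trans (lintegral_mono fun v => ?_)
    exact ENNReal.ofReal_le_ofReal (hZ1 v)
  have hzpos : 0 < z := by
    rw [hz, setLIntegral_pos_iff hMm]
    refine lt_of_lt_of_le (Metric.measure_ball_pos volume (0 : Vel d) one_pos) (measure_mono ?_)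
    refine fun v hv => ⟨?_, Metric.ball_subset_closedBall hv⟩
    rw [Function.mem_support]
    exact (ENNReal.ofReal_pos.2 (maxwellian_pos v)).ne'
  have hzr : 0 < z.toReal := ENNReal.toReal_pos hzpos.ne' hzfin.ne
  set r : ℝ := c * z.toReal / (2 * (C * Z.toReal + 1)) with hr
  have hZr : 0 ≤ Z.toReal := ENNReal.toReal_nonneg
  have hrpos : 0 < r := by positivity
  -- Large enough for `a² / 24 ≥ |log r|`, so that `exp (-a² / 24) ≤ r`; `r` is the threshold below
  -- which the gain is at most half of the loss.
  set a : ℝ := 2 + 24 * |Real.log r| with ha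
  have hLr := abs_nonneg (Real.log r)
  have ha2 : 2 ≤ a := by linarith
  have hexp : Real.exp (-(a ^ 2 / 24)) ≤ r := by
    rw [← Real.le_log_iff_exp_le hrpos]
    have := neg_abs_le (Real.log r)
    nlinarith
  have hκ : C * Real.exp (-(a ^ 2 / 24)) * Z.toReal ≤ c * z.toReal / 2 := by
    calc _ ≤ C * r * Z.toReal := by gcongr
      _ = c * z.toReal / 2 * (C * Z.toReal / (C * Z.toReal + 1)) := by rw [hr]; field_simp
      _ ≤ c * z.toReal / 2 * 1 := by
          gcongr
          exact div_le_one_of_le₀ (by linarith) (by positivity)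
      _ = _ := mul_one _
  refine ⟨a, c * z.toReal, 6 * a + 1, by linarith, by positivity, by linarith, fun h hh hN => ?_⟩
  obtain ⟨N, hN⟩ := hN
  set κ := c * z.toReal with hκdef
  have hκpos : 0 < κ := by positivity
  set W : Vel d → ENNReal := fun v => ENNReal.ofReal (maxwellian v * h v ^ 2 * bracket v ^ s) with hW
  have hWm : Measurable W := ((continuous_maxwellian.measurable.mul (hh.pow_const 2)).mul
    (measurable_bracket_rpow s)).ennreal_ofReal
  have hbr : ∀ v : Vel d, 0 < bracket v := fun v => by linarith [one_le_bracket v]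
  -- Boundedness of `h` is needed only for this finiteness, which allows the exterior part of the
  -- gain to be subtracted at the end.
  have hWfin : ∫⁻ v, W v < ⊤ := by
    have : ∀ v, W v ≤ ENNReal.ofReal (N ^ 2) * ENNReal.ofReal ((2 * (1 + ‖v‖)) ^ |s| *
        (maxwellian v * Real.exp (3 / 8 * ‖v‖ ^ 2))) := fun v => by
      rw [← ENNReal.ofReal_mul (by positivity)]
      refine ENNReal.ofReal_le_ofReal ?_
      have h1 : h v ^ 2 ≤ N ^ 2 := sq_le_sq' (abs_le.1 (hN v)).1 (abs_le.1 (hN v)).2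
      have h2 := bracket_rpow_le v s
      have h3 := maxwellian_pos v
      have h4 : 1 ≤ Real.exp (3 / 8 * ‖v‖ ^ 2) := Real.one_le_exp (by positivity)
      have h5 := hbr v
      calc _ ≤ maxwellian v * N ^ 2 * (2 * (1 + ‖v‖)) ^ |s| := by gcongr
        _ = N ^ 2 * ((2 * (1 + ‖v‖)) ^ |s| * (maxwellian v * 1)) := by ring
        _ ≤ _ := by gcongr
    refine lt_of_le_of_lt (lintegral_mono this) ?_
    rw [lintegral_const_mul' _ _ ENNReal.ofReal_ne_top]
    exact ENNReal.mul_lt_top ENNReal.ofReal_lt_top hZfin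
  have key := two_mul_lintegral_le hd s a hh
  set D0 := ∫⁻ p : Vel d × Vel d × Sph d,
          ENNReal.ofReal (subKernel d s a (‖p.1 - p.2.1‖, cosTheta p.1 p.2.1 p.2.2)) *
            ENNReal.ofReal (maxwellian p.1 * maxwellian p.2.1) *
            ENNReal.ofReal ((h p.1 - h (vPrime p.1 p.2.1 p.2.2)) ^ 2) ∂(collMeasure d)
  have hK := measurable_sub_weight (d := d) s a
  have hgain : ∫⁻ p : Vel d × Vel d × Sph d,
        ENNReal.ofReal (subKernel d s a (‖p.1 - p.2.1‖, cosTheta p.1 p.2.1 p.2.2)) *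
          ENNReal.ofReal (maxwellian p.1 * maxwellian p.2.1) *
          ENNReal.ofReal (h p.1 ^ 2 *
            Real.exp ((‖vPrime p.1 p.2.1 p.2.2‖ ^ 2 - ‖p.1‖ ^ 2) / 4)) ∂(collMeasure d) ≤
      ENNReal.ofReal (κ / 2) * ∫⁻ v, W v := by
    have hH1 : Measurable fun q : Vel d × Vel d => ENNReal.ofReal (h q.1 ^ 2 *
        Real.exp ((‖q.2‖ ^ 2 - ‖q.1‖ ^ 2) / 4)) :=
      (((hh.comp measurable_fst).pow_const 2).mul (by fun_prop)).ennreal_ofReal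
    refine (lintegral_collMeasure (hK.mul (hH1.comp
      (measurable_fst.prodMk measurable_vPrime)))).le.trans ?_
    rw [← lintegral_const_mul _ hWm]
    refine lintegral_mono fun v => ?_
    have hM := maxwellian_pos v
    have hb := hbr v
    calc _ ≤ ∫⁻ vs, ENNReal.ofReal (maxwellian v * h v ^ 2 * bracket v ^ s *
          (C * Real.exp (-(a ^ 2 / 24)))) * ENNReal.ofReal ((2 * (1 + ‖vs‖)) ^ |s| *
            (maxwellian vs * Real.exp (3 / 8 * ‖vs‖ ^ 2))) := by
          refine lintegral_mono fun vs => ?_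
          have hMs := maxwellian_pos vs
          calc _ ≤ ∫⁻ σ, ENNReal.ofReal (subKernel d s a (‖v - vs‖, cosTheta v vs σ)) *
                ENNReal.ofReal (maxwellian v * maxwellian vs * h v ^ 2 *
                  (Real.exp (3 / 8 * ‖vs‖ ^ 2) * Real.exp (-(a ^ 2 / 24)))) ∂(surfaceMeasure d) := by
                refine lintegral_mono fun σ => ?_
                simp only [Pi.mul_apply, Function.comp]
                by_cases hw : (‖v - vs‖, cosTheta v vs σ) ∈ {p : ℝ × ℝ |
                    a ^ 2 ≤ p.1 ^ 2 * (1 - p.2) ∧ p.1 ^ 2 * (1 - p.2) ≤ 16 * a ^ 2}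
                swap
                · rw [subKernel, indicator_of_notMem hw, ENNReal.ofReal_zero, zero_mul, zero_mul,
                    zero_mul]
                rw [mul_assoc]
                refine mul_le_mul' le_rfl ?_
                rw [← ENNReal.ofReal_mul (by positivity), ← Real.exp_add]
                refine ENNReal.ofReal_le_ofReal ?_
                rw [← mul_assoc]
                gcongr
                have := energy_gain_le (v := v) (vs := vs) (σ := σ) hw.1
                linarith
            _ ≤ ENNReal.ofReal (C * ((2 * (1 + ‖vs‖)) ^ |s| * bracket v ^ s)) *
                ENNReal.ofReal (maxwellian v * maxwellian vs * h v ^ 2 *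
                  (Real.exp (3 / 8 * ‖vs‖ ^ 2) * Real.exp (-(a ^ 2 / 24)))) := by
                rw [lintegral_mul_const' _ _ ENNReal.ofReal_ne_top]
                exact mul_le_mul' (hker a ha2 v vs).1 le_rfl
            _ = _ := by
                rw [← ENNReal.ofReal_mul (by positivity), ← ENNReal.ofReal_mul (by positivity)]
                congr 1
                ring
      _ = ENNReal.ofReal (maxwellian v * h v ^ 2 * bracket v ^ s *
          (C * Real.exp (-(a ^ 2 / 24)))) * ENNReal.ofReal Z.toReal := by
          rw [lintegral_const_mul' _ _ ENNReal.ofReal_ne_top, ENNReal.ofReal_toReal hZfin.ne]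
      _ ≤ _ := by
          rw [hW, ← ENNReal.ofReal_mul (by positivity), ← ENNReal.ofReal_mul (by positivity)]
          refine ENNReal.ofReal_le_ofReal ?_
          calc _ = C * Real.exp (-(a ^ 2 / 24)) * Z.toReal *
                (maxwellian v * h v ^ 2 * bracket v ^ s) := by ring
            _ ≤ _ := by gcongr
  have hloss : ENNReal.ofReal κ * ∫⁻ v in (Metric.ball 0 (6 * a + 1))ᶜ, W v ≤
      ∫⁻ p : Vel d × Vel d × Sph d,
        ENNReal.ofReal (subKernel d s a (‖p.1 - p.2.1‖, cosTheta p.1 p.2.1 p.2.2)) *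
          ENNReal.ofReal (maxwellian p.1 * maxwellian p.2.1) * ENNReal.ofReal (h p.1 ^ 2)
          ∂(collMeasure d) := by
    have hH2 : Measurable fun v : Vel d => ENNReal.ofReal (h v ^ 2) := (hh.pow_const 2).ennreal_ofReal
    refine le_trans ?_ (lintegral_collMeasure (hK.mul (hH2.comp measurable_fst))).ge
    rw [← lintegral_const_mul _ hWm, ← lintegral_indicator measurableSet_ball.compl]
    refine lintegral_mono fun v => ?_
    by_cases hv : v ∈ (Metric.ball (0 : Vel d) (6 * a + 1))ᶜ
    swap
    · rw [indicator_of_notMem hv]; exact bot_le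
    rw [indicator_of_mem hv]
    have hv' : 6 * a + 1 ≤ ‖v‖ := by simpa using hv
    have hM := maxwellian_pos v
    have hb := hbr v
    calc _ = ENNReal.ofReal (maxwellian v * h v ^ 2 * (c * bracket v ^ s)) * z := by
          rw [← ENNReal.ofReal_toReal hzfin.ne, hW, ← ENNReal.ofReal_mul (by positivity),
            ← ENNReal.ofReal_mul (by positivity)]
          congr 1
          rw [hκdef]
          ring
      _ = ∫⁻ vs in Metric.closedBall (0 : Vel d) 1,
            ENNReal.ofReal (maxwellian v * h v ^ 2 * (c * bracket v ^ s)) *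
              ENNReal.ofReal (maxwellian vs) := by
          rw [lintegral_const_mul' _ _ ENNReal.ofReal_ne_top]
      _ ≤ _ := by
          rw [← lintegral_indicator measurableSet_closedBall]
          refine lintegral_mono fun vs => ?_
          by_cases hvs : vs ∈ Metric.closedBall (0 : Vel d) 1
          swap
          · rw [indicator_of_notMem hvs]; exact bot_le
          rw [indicator_of_mem hvs]
          have hMs := maxwellian_pos vs
          simp only [Pi.mul_apply, Function.comp]
          rw [lintegral_mul_const' _ _ ENNReal.ofReal_ne_top,
            lintegral_mul_const' _ _ ENNReal.ofReal_ne_top]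
          refine le_trans (le_of_eq ?_) (mul_le_mul' (mul_le_mul'
            ((hker a ha2 v vs).2 hv' (by simpa using hvs)) le_rfl) le_rfl)
          rw [← ENNReal.ofReal_mul (by positivity), ← ENNReal.ofReal_mul (by positivity),
            ← ENNReal.ofReal_mul (by positivity)]
          congr 1
          ring
  have hsplit : (∫⁻ v in Metric.ball 0 (6 * a + 1), W v) + ∫⁻ v in (Metric.ball 0 (6 * a + 1))ᶜ, W v =
      ∫⁻ v, W v := lintegral_add_compl W measurableSet_ball
  set X := ∫⁻ v in Metric.ball 0 (6 * a + 1), W v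
  set Y := ∫⁻ v in (Metric.ball 0 (6 * a + 1))ᶜ, W v
  have hYfin : Y < ⊤ := lt_of_le_of_lt (by rw [← hsplit]; exact le_add_self) hWfin
  have hkY : ENNReal.ofReal κ * Y ≠ ⊤ := (ENNReal.mul_lt_top ENNReal.ofReal_lt_top hYfin).ne
  -- The estimates combine to `2 κ Y ≤ D0 + κ (X + Y)`, and one `κ Y` cancels.
  refine ENNReal.le_of_add_le_add_right hkY ?_
  calc ENNReal.ofReal κ * Y + ENNReal.ofReal κ * Y = 2 * (ENNReal.ofReal κ * Y) := (two_mul _).symm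
    _ ≤ D0 + 2 * (ENNReal.ofReal (κ / 2) * (X + Y)) := by
        refine le_trans (mul_le_mul' le_rfl hloss) (key.trans ?_)
        rw [hsplit]
        gcongr
    _ = _ := by
        rw [← mul_assoc, ← ENNReal.ofReal_ofNat, ← ENNReal.ofReal_mul (by norm_num),
          mul_div_cancel₀ κ two_ne_zero, mul_add, add_assoc]

/-! ### Normalisation, and removal of the boundedness assumption -/

theorem integral_maxwellian {d : ℕ} : ∫ v : Vel d, maxwellian v = 1 := by
  have h : ∀ v : Vel d, maxwellian v =
      1 / (2 * Real.pi) ^ ((d : ℝ) / 2) * Real.exp (-(1 / 2) * ‖v‖ ^ 2) := fun v => by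
    rw [maxwellian]; congr 2; ring
  simp_rw [h]
  rw [integral_const_mul, GaussianFourier.integral_rexp_neg_mul_sq_norm (by norm_num)]
  rw [finrank_euclideanSpace, Fintype.card_fin, div_div_eq_mul_div, div_one, mul_comm Real.pi 2]
  have : 0 < (2 * Real.pi) ^ ((d : ℝ) / 2) := by positivity
  field_simp

theorem integrable_maxwellian {d : ℕ} : Integrable (maxwellian : Vel d → ℝ) := by
  by_contra h
  have h1 := integral_undef h
  rw [integral_maxwellian] at h1
  exact one_ne_zero h1

theorem lintegral_maxwellian_mul_bracket_lt_top {d : ℕ} (s : ℝ) :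
    ∫⁻ v : Vel d, ENNReal.ofReal (maxwellian v * bracket v ^ s) < ⊤ := by
  refine lt_of_le_of_lt (lintegral_mono fun v => ENNReal.ofReal_le_ofReal ?_)
    (lintegral_moment_lt_top (d := d) (abs_nonneg s))
  have h2 := bracket_rpow_le v s
  have h3 := maxwellian_pos v
  have h4 : 1 ≤ Real.exp (3 / 8 * ‖v‖ ^ 2) := Real.one_le_exp (by positivity)
  calc _ ≤ maxwellian v * (2 * (1 + ‖v‖)) ^ |s| := by gcongr
    _ = (2 * (1 + ‖v‖)) ^ |s| * (maxwellian v * 1) := by ring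
    _ ≤ _ := by gcongr

theorem abs_clip_sub_clip_le (n x y : ℝ) :
    |max (-n) (min n x) - max (-n) (min n y)| ≤ |x - y| := by
  rw [max_comm, max_comm (-n) (min n y), min_comm, min_comm n y]
  exact (abs_max_sub_max_le_abs _ _ _).trans (by
    simpa using abs_min_sub_min_le_max x n y n)

theorem abs_max_neg_min_le {n : ℝ} (hn : 0 ≤ n) (x : ℝ) : |max (-n) (min n x)| ≤ n :=
  abs_le.2 ⟨le_max_left _ _, max_le (by linarith) (min_le_left _ _)⟩

theorem max_neg_min_eq_self {n x : ℝ} (h : |x| ≤ n) : max (-n) (min n x) = x := by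
  rw [min_eq_right (abs_le.1 h).2, max_eq_right (abs_le.1 h).1]

/-- Passage to unbounded functions in the bound outside a ball. -/
theorem exists_lyapunov_bound_of_measurable {d : ℕ} (hd : 2 ≤ d) (s : ℝ) :
    ∃ a κ R : ℝ, 0 < a ∧ 0 < κ ∧ 0 < R ∧ ∀ h : Vel d → ℝ, Measurable h → ∀ m : ℝ,
      ENNReal.ofReal κ * ∫⁻ v in (Metric.ball 0 R)ᶜ,
          ENNReal.ofReal (maxwellian v * (h v - m) ^ 2 * bracket v ^ s) ≤
        ∫⁻ p : Vel d × Vel d × Sph d,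
          ENNReal.ofReal (subKernel d s a (‖p.1 - p.2.1‖, cosTheta p.1 p.2.1 p.2.2)) *
            ENNReal.ofReal (maxwellian p.1 * maxwellian p.2.1) *
            ENNReal.ofReal ((h p.1 - h (vPrime p.1 p.2.1 p.2.2)) ^ 2) ∂(collMeasure d) +
        ENNReal.ofReal κ * ∫⁻ v in Metric.ball 0 R,
          ENNReal.ofReal (maxwellian v * (h v - m) ^ 2 * bracket v ^ s) := by
  obtain ⟨a, κ, R, ha, hκ, hR, hmain⟩ := exists_lyapunov_bound hd s
  refine ⟨a, κ, R, ha, hκ, hR, fun h hh m => ?_⟩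
  -- Clipping is a contraction fixing `0`, so it decreases both the increments and the integral over
  -- the ball. Fatou's lemma handles the left side as the level grows. Subtracting `m` does not
  -- change increments.
  set T : ℕ → Vel d → ℝ := fun n v => max (-(n : ℝ)) (min n (h v - m)) with hT
  have hTm : ∀ n, Measurable (T n) := fun n =>
    measurable_const.max (measurable_const.min (hh.sub_const m))
  have hbr : ∀ v : Vel d, 0 < bracket v := fun v => by linarith [one_le_bracket v]
  have hWm : ∀ n, Measurable fun v => ENNReal.ofReal (maxwellian v * T n v ^ 2 * bracket v ^ s) :=
    fun n => ((continuous_maxwellian.measurable.mul ((hTm n).pow_const 2)).mul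
      (measurable_bracket_rpow s)).ennreal_ofReal
  have hlim : ∀ v, Filter.liminf (fun n => ENNReal.ofReal (maxwellian v * T n v ^ 2 * bracket v ^ s))
      Filter.atTop = ENNReal.ofReal (maxwellian v * (h v - m) ^ 2 * bracket v ^ s) := fun v => by
    refine Filter.Tendsto.liminf_eq (tendsto_const_nhds.congr' ?_)
    filter_upwards [Filter.eventually_ge_atTop ⌈|h v - m|⌉₊] with n hn
    simp only [hT]
    rw [max_neg_min_eq_self (Nat.ceil_le.1 hn)]
  rw [ENNReal.mul_le_iff_le_inv (ENNReal.ofReal_pos.2 hκ).ne' ENNReal.ofReal_ne_top]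
  simp_rw [← hlim]
  refine (lintegral_liminf_le hWm).trans (Filter.liminf_le_of_frequently_le'
    (Filter.Eventually.of_forall fun n => ?_).frequently)
  rw [← ENNReal.mul_le_iff_le_inv (ENNReal.ofReal_pos.2 hκ).ne' ENNReal.ofReal_ne_top]
  refine (hmain (T n) (hTm n) ⟨n, fun v => abs_max_neg_min_le n.cast_nonneg _⟩).trans ?_
  simp_rw [hlim]
  refine add_le_add (lintegral_mono fun p => ?_) (mul_le_mul' le_rfl (lintegral_mono fun v => ?_))
  · refine mul_le_mul' le_rfl (ENNReal.ofReal_le_ofReal ?_)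
    refine sq_le_sq.2 ((abs_clip_sub_clip_le _ _ _).trans_eq ?_)
    rw [sub_sub_sub_cancel_right]
  · refine ENNReal.ofReal_le_ofReal ?_
    have h3 := maxwellian_pos v
    have h4 := hbr v
    have h5 : T n v ^ 2 ≤ (h v - m) ^ 2 := by
      have := abs_clip_sub_clip_le n (h v - m) 0
      rw [max_neg_min_eq_self (x := 0) (by simp), sub_zero, sub_zero] at this
      exact sq_le_sq.2 this
    gcongr

/-! ### Global weighted Poincaré inequality -/

/-- Weighted Poincaré inequality, up to a constant that is not identified. -/
theorem exists_weighted_poincare {d : ℕ} (hd : 2 ≤ d) {γ ν c : ℝ} (hγ : γ < 0) (hν : 0 < ν)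
    (hc : 0 < c) {b : ℝ → ℝ}
    (hb : ∀ x, -1 ≤ x → x < 1 → c * (1 - x) ^ (-(((d : ℝ) - 1 + ν) / 2)) ≤ b x) :
    ∃ C : ℝ, 0 < C ∧ ∀ f : Vel d → ℝ, Measurable f → ∃ m : ℝ,
      ∫⁻ v, ENNReal.ofReal (maxwellian v * (f v / maxwellian v - m) ^ 2 * bracket v ^ (γ + ν)) ≤
        ENNReal.ofReal C * dirichlet γ b f := by
  have hd' : (2 : ℝ) ≤ d := by exact_mod_cast hd
  set s := γ + ν with hs
  obtain ⟨a, κ, R, ha, hκ, hR, hlyap⟩ := exists_lyapunov_bound_of_measurable hd s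
  obtain ⟨C₂, hC₂, hloc⟩ := exists_local_poincare hd hγ (by linarith) hc hb hR
  set C₁ : ℝ := (a ^ (d - 1))⁻¹ * (c * (16 * a ^ 2) ^ (-(((d : ℝ) - 1 + ν) / 2)))⁻¹ with hC₁
  have hC₁pos : 0 < C₁ := by positivity
  set Kb : ℝ := maxwellian (0 : Vel d) * (2 * (1 + R)) ^ |s| with hKb
  have hM0 := maxwellian_pos (0 : Vel d)
  have hKbpos : 0 < Kb := by positivity
  refine ⟨κ⁻¹ * (2 * C₁ + κ * (Kb * C₂)) + Kb * C₂, by positivity, fun f hf => ?_⟩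
  obtain ⟨m, hm⟩ := hloc f hf
  refine ⟨m, ?_⟩
  set h : Vel d → ℝ := fun v => f v / maxwellian v with hh
  have hhm : Measurable h := hf.div continuous_maxwellian.measurable
  have hball : ∫⁻ v in Metric.ball 0 R,
      ENNReal.ofReal (maxwellian v * (h v - m) ^ 2 * bracket v ^ s) ≤
      ENNReal.ofReal (Kb * C₂) * dirichlet γ b f := by
    rw [ENNReal.ofReal_mul hKbpos.le, mul_assoc]
    refine le_trans ?_ (mul_le_mul' le_rfl hm)
    rw [← lintegral_const_mul' _ _ ENNReal.ofReal_ne_top]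
    refine setLIntegral_mono' measurableSet_ball fun v hv => ?_
    rw [← ENNReal.ofReal_mul hKbpos.le]
    refine ENNReal.ofReal_le_ofReal ?_
    rw [mem_ball_zero_iff] at hv
    have h1 : maxwellian v ≤ maxwellian (0 : Vel d) := maxwellian_anti (by simp)
    have h2 : bracket v ^ s ≤ (2 * (1 + R)) ^ |s| := by
      refine (bracket_rpow_le v s).trans ?_
      gcongr
    have h3 : 0 ≤ bracket v ^ s := Real.rpow_nonneg (by linarith [one_le_bracket v]) s
    calc _ = maxwellian v * bracket v ^ s * (h v - m) ^ 2 := by ring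
      _ ≤ _ := by
        rw [hKb]
        gcongr
  have hD : ∫⁻ p : Vel d × Vel d × Sph d,
          ENNReal.ofReal (subKernel d s a (‖p.1 - p.2.1‖, cosTheta p.1 p.2.1 p.2.2)) *
            ENNReal.ofReal (maxwellian p.1 * maxwellian p.2.1) *
            ENNReal.ofReal ((h p.1 - h (vPrime p.1 p.2.1 p.2.2)) ^ 2) ∂(collMeasure d) ≤
      ENNReal.ofReal (2 * C₁) * dirichlet γ b f := by
    refine le_trans (le_of_eq (lintegral_congr fun p => ?_)) (lintegral_le_dirichlet (γ := γ) (b := b)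
      (C := C₁) hC₁pos.le
      (g := fun p : Vel d × Vel d × Sph d => subKernel d s a (‖p.1 - p.2.1‖, cosTheta p.1 p.2.1 p.2.2) *
        (maxwellian p.1 * maxwellian p.2.1)) (fun p hp hx => ?_) f)
    · have h1 : 0 ≤ subKernel d s a (‖p.1 - p.2.1‖, cosTheta p.1 p.2.1 p.2.2) :=
        subKernel_nonneg ha (norm_nonneg _)
      have h2 := maxwellian_pos p.1
      have h3 := maxwellian_pos p.2.1
      rw [← ENNReal.ofReal_mul h1, ← ENNReal.ofReal_mul (by positivity), increment]
    · have h1 := subKernel_le (γ := γ) hd hν hc ha hb (norm_pos_iff.2 (sub_ne_zero.2 hp))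
        (abs_le.1 (abs_cosTheta_le p.1 p.2.1 p.2.2)).1 hx
      have h2 := maxwellian_pos p.1
      have h3 := maxwellian_pos p.2.1
      calc _ ≤ C₁ * (‖p.1 - p.2.1‖ ^ γ * b (cosTheta p.1 p.2.1 p.2.2)) *
            (maxwellian p.1 * maxwellian p.2.1) := by gcongr
        _ = _ := by rw [collWeight, kernelB]; ring
  have hout : ∫⁻ v in (Metric.ball 0 R)ᶜ,
      ENNReal.ofReal (maxwellian v * (h v - m) ^ 2 * bracket v ^ s) ≤
      ENNReal.ofReal (κ⁻¹ * (2 * C₁ + κ * (Kb * C₂))) * dirichlet γ b f := by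
    rw [ENNReal.ofReal_mul (by positivity), ENNReal.ofReal_inv_of_pos hκ, mul_assoc,
      ← ENNReal.mul_le_iff_le_inv (ENNReal.ofReal_pos.2 hκ).ne' ENNReal.ofReal_ne_top]
    refine (hlyap h hhm m).trans ((add_le_add hD (mul_le_mul' le_rfl hball)).trans_eq ?_)
    rw [ENNReal.ofReal_add (by positivity) (by positivity), ENNReal.ofReal_mul hκ.le (q := Kb * C₂)]
    ring
  rw [← lintegral_add_compl _ (measurableSet_ball (x := (0 : Vel d)) (ε := R)), add_comm,
    ENNReal.ofReal_add (by positivity) (by positivity), add_mul]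
  exact add_le_add hout hball

/-- The constant of the weighted Poincaré inequality may be replaced by the mass. -/
theorem exists_sqNorm_sub_mass_le {d : ℕ} (s : ℝ) : ∃ C : ℝ, 0 < C ∧
    ∀ f : Vel d → ℝ, Measurable f → Integrable f → ∀ m : ℝ,
      sqNorm s (fun v => f v - mass f * maxwellian v) ≤ ENNReal.ofReal C *
        ∫⁻ v, ENNReal.ofReal (maxwellian v * (f v / maxwellian v - m) ^ 2 * bracket v ^ s) := by
  have hbr : ∀ v : Vel d, 0 < bracket v := fun v => by linarith [one_le_bracket v]
  have hZ := lintegral_maxwellian_mul_bracket_lt_top (d := d) s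
  have hZ' := lintegral_maxwellian_mul_bracket_lt_top (d := d) (-s)
  set Z := ∫⁻ v : Vel d, ENNReal.ofReal (maxwellian v * bracket v ^ s)
  set Z' := ∫⁻ v : Vel d, ENNReal.ofReal (maxwellian v * bracket v ^ (-s)) with hZ'def
  refine ⟨2 + 2 * (Z'.toReal * Z.toReal), by positivity, fun f hf hfi m => ?_⟩
  set h : Vel d → ℝ := fun v => f v / maxwellian v with hh
  have hhm : Measurable h := hf.div continuous_maxwellian.measurable
  have hfh : ∀ v, f v = h v * maxwellian v := fun v => by
    simp only [hh]; rw [div_mul_cancel₀ _ (maxwellian_pos v).ne']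
  set A := ∫⁻ v, ENNReal.ofReal (maxwellian v * (h v - m) ^ 2 * bracket v ^ s)
  have hmass : mass f - m = ∫ v, (h v - m) * maxwellian v := by
    have h1 : ∀ v, (h v - m) * maxwellian v = f v - m * maxwellian v := fun v => by
      rw [hfh v]; ring
    simp_rw [h1]
    rw [integral_sub hfi (integrable_maxwellian.const_mul m), integral_const_mul,
      integral_maxwellian, mul_one, mass]
  -- Cauchy–Schwarz with `|h - m| M` split as the square root of `M (h - m)² ⟨v⟩^s` times that of `M
  -- ⟨v⟩^(-s)`. The Gaussian makes the second factor square integrable for either sign of `s`.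
  have hCS : ENNReal.ofReal ((mass f - m) ^ 2) ≤ A * Z' := by
    have h1 : ENNReal.ofReal |mass f - m| ≤ A ^ (1 / 2 : ℝ) * Z' ^ (1 / 2 : ℝ) := by
      rw [hmass, ← Real.norm_eq_abs, ofReal_norm]
      refine (enorm_integral_le_lintegral_enorm _).trans ?_
      have hm1 : Measurable fun v => ENNReal.ofReal (Real.sqrt (maxwellian v * (h v - m) ^ 2 *
          bracket v ^ s)) :=
        ((continuous_maxwellian.measurable.mul ((hhm.sub_const m).pow_const 2)).mul
          (measurable_bracket_rpow s)).sqrt.ennreal_ofReal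
      have hm2 : Measurable fun v : Vel d => ENNReal.ofReal (Real.sqrt (maxwellian v *
          bracket v ^ (-s))) :=
        (continuous_maxwellian.measurable.mul (measurable_bracket_rpow (-s))).sqrt.ennreal_ofReal
      have hH := ENNReal.lintegral_mul_le_Lp_mul_Lq volume Real.HolderConjugate.two_two
        hm1.aemeasurable hm2.aemeasurable
      refine le_trans (le_of_eq (lintegral_congr fun v => ?_)) (hH.trans_eq ?_)
      · have h3 := maxwellian_pos v
        have h4 := hbr v
        simp only [Pi.mul_apply]
        rw [← ENNReal.ofReal_mul (Real.sqrt_nonneg _), ← Real.sqrt_mul (by positivity),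
          ← ofReal_norm, Real.norm_eq_abs, ← Real.sqrt_sq_eq_abs]
        congr 2
        rw [Real.rpow_neg h4.le]
        have : bracket v ^ s ≠ 0 := by positivity
        field_simp
      · congr 2
        · refine lintegral_congr fun v => ?_
          have h3 := maxwellian_pos v
          have h4 := hbr v
          rw [ENNReal.rpow_two, ← ENNReal.ofReal_pow (Real.sqrt_nonneg _), Real.sq_sqrt (by positivity)]
        · refine lintegral_congr fun v => ?_
          have h3 := maxwellian_pos v
          have h4 := hbr v
          rw [ENNReal.rpow_two, ← ENNReal.ofReal_pow (Real.sqrt_nonneg _), Real.sq_sqrt (by positivity)]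
    have h2 := pow_le_pow_left' h1 2
    rw [← ENNReal.ofReal_pow (abs_nonneg _), sq_abs, mul_pow, ← ENNReal.rpow_two, ← ENNReal.rpow_two,
      ← ENNReal.rpow_mul, ← ENNReal.rpow_mul] at h2
    norm_num at h2
    exact h2
  have hWm : Measurable fun v => ENNReal.ofReal (2 * (maxwellian v * (h v - m) ^ 2 * bracket v ^ s)) :=
    (((continuous_maxwellian.measurable.mul ((hhm.sub_const m).pow_const 2)).mul
      (measurable_bracket_rpow s)).const_mul 2).ennreal_ofReal
  calc sqNorm s (fun v => f v - mass f * maxwellian v)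
      ≤ ∫⁻ v, (ENNReal.ofReal (2 * (maxwellian v * (h v - m) ^ 2 * bracket v ^ s)) +
          ENNReal.ofReal (2 * (mass f - m) ^ 2 * (maxwellian v * bracket v ^ s))) := by
        refine lintegral_mono fun v => ?_
        have h3 := maxwellian_pos v
        have h4 := hbr v
        have h5 : 0 < bracket v ^ s := by positivity
        rw [← ENNReal.ofReal_add (by positivity) (by positivity)]
        refine ENNReal.ofReal_le_ofReal ?_
        simp only [hfh v]
        rw [show (h v * maxwellian v - mass f * maxwellian v) ^ 2 * bracket v ^ s / maxwellian v
          = (h v - mass f) ^ 2 * (maxwellian v * bracket v ^ s) by field_simp]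
        have h6 : (h v - mass f) ^ 2 ≤ 2 * (h v - m) ^ 2 + 2 * (mass f - m) ^ 2 := by
          nlinarith [sq_nonneg (h v - m + (mass f - m))]
        calc _ ≤ (2 * (h v - m) ^ 2 + 2 * (mass f - m) ^ 2) * (maxwellian v * bracket v ^ s) := by
              gcongr
          _ = _ := by ring
    _ = 2 * A + 2 * ENNReal.ofReal ((mass f - m) ^ 2) * Z := by
        rw [lintegral_add_left hWm]
        simp_rw [ENNReal.ofReal_mul (zero_le_two (α := ℝ)), ENNReal.ofReal_mul (mul_nonneg
          (zero_le_two (α := ℝ)) (sq_nonneg (mass f - m))), ENNReal.ofReal_mul (zero_le_two (α := ℝ))]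
        rw [lintegral_const_mul' _ _ ENNReal.ofReal_ne_top, lintegral_const_mul' _ _
          (ENNReal.mul_ne_top ENNReal.ofReal_ne_top ENNReal.ofReal_ne_top), ENNReal.ofReal_ofNat]
    _ ≤ 2 * A + 2 * (A * Z') * Z := by gcongr
    _ = _ := by
        rw [ENNReal.ofReal_add (by positivity) (by positivity), ENNReal.ofReal_mul (by norm_num),
          ENNReal.ofReal_mul (by positivity), ENNReal.ofReal_toReal hZ.ne,
          ENNReal.ofReal_toReal hZ'.ne, ENNReal.ofReal_ofNat]
        ring

/-! ### Independence of representatives, and coercivity -/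

theorem increment_congr_ae {d : ℕ} (hd : 2 ≤ d) {f g : Vel d → ℝ} (h : f =ᵐ[volume] g) :
    increment f =ᵐ[collMeasure d] increment g := by
  filter_upwards [quasiMeasurePreserving_fst.ae h, (quasiMeasurePreserving_vPrime hd).ae h]
    with p h1 h2
  simp only [increment, h1, h2]

theorem dirichlet_congr_ae {d : ℕ} (hd : 2 ≤ d) {γ : ℝ} {b : ℝ → ℝ} {f g : Vel d → ℝ}
    (h : f =ᵐ[volume] g) : dirichlet γ b f = dirichlet γ b g := by
  rw [dirichlet, dirichlet]
  congr 1
  refine lintegral_congr_ae ?_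
  filter_upwards [increment_congr_ae hd h] with p hp
  rw [hp]

theorem sqNorm_congr_ae {d : ℕ} {s : ℝ} {f g : Vel d → ℝ} (h : f =ᵐ[volume] g) :
    sqNorm s f = sqNorm s g := by
  refine lintegral_congr_ae ?_
  filter_upwards [h] with v hv
  rw [hv]

theorem sqNorm_mono {d : ℕ} {s t : ℝ} (h : s ≤ t) (f : Vel d → ℝ) : sqNorm s f ≤ sqNorm t f := by
  refine lintegral_mono fun v => ENNReal.ofReal_le_ofReal ?_
  have h1 := maxwellian_pos v
  have h2 := one_le_bracket v
  gcongr

/-- The coercivity of the Dirichlet form in the weighted norm of exponent `γ + ν`. -/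
theorem exists_coercivity {d : ℕ} (hd : 2 ≤ d) {γ ν c : ℝ} (hγ : γ < 0) (hν : 0 < ν)
    (hc : 0 < c) {b : ℝ → ℝ}
    (hb : ∀ x, -1 ≤ x → x < 1 → c * (1 - x) ^ (-(((d : ℝ) - 1 + ν) / 2)) ≤ b x) :
    ∃ C : ℝ, 0 < C ∧ ∀ f : Vel d → ℝ, Integrable f →
      ENNReal.ofReal C * sqNorm (γ + ν) (fun v => f v - mass f * maxwellian v) ≤
        dirichlet γ b f := by
  obtain ⟨C₁, hC₁, h1⟩ := exists_weighted_poincare hd hγ hν hc hb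
  obtain ⟨C₂, hC₂, h2⟩ := exists_sqNorm_sub_mass_le (d := d) (γ + ν)
  refine ⟨(C₂ * C₁)⁻¹, by positivity, fun f hf => ?_⟩
  -- The earlier bounds need a Borel function; every quantity involved depends only on the almost
  -- everywhere class.
  obtain ⟨g, hg, hfg⟩ := hf.aestronglyMeasurable.aemeasurable
  obtain ⟨m, hm⟩ := h1 g hg
  have hmass : mass f = mass g := integral_congr_ae hfg
  have hsub : (fun v => f v - mass f * maxwellian v) =ᵐ[volume]
      fun v => g v - mass g * maxwellian v := by
    filter_upwards [hfg] with v hv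
    rw [hv, hmass]
  rw [dirichlet_congr_ae hd hfg, sqNorm_congr_ae hsub, ENNReal.ofReal_inv_of_pos (by positivity)]
  rw [ENNReal.inv_mul_le_iff (ENNReal.ofReal_pos.2 (by positivity)).ne' ENNReal.ofReal_ne_top,
    ENNReal.ofReal_mul hC₂.le, mul_assoc]
  exact (h2 g hg (hf.congr hfg) m).trans (mul_le_mul' le_rfl hm)

/-! ### Abstract resolvent equation for a form with a gap -/

/-- Solvability of the resolvent equation of the operator associated with a closed form with a
spectral gap. -/
theorem exists_resolvent_solution {V H₁ H₂ : Type*} [NormedAddCommGroup V] [InnerProductSpace ℝ V] [CompleteSpace V]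
    [NormedAddCommGroup H₁] [InnerProductSpace ℝ H₁] [CompleteSpace H₁] [NormedAddCommGroup H₂]
    [InnerProductSpace ℝ H₂] (P₁ : V →L[ℝ] H₁) (P₂ : V →L[ℝ] H₂)
    (hV : ∀ x, ‖x‖ ^ 2 = ‖P₁ x‖ ^ 2 + ‖P₂ x‖ ^ 2) {m : V} (hm₁ : ‖P₁ m‖ = 1) (hm₂ : P₂ m = 0)
    {lam : ℝ} (hlam : 0 < lam)
    (hgap : ∀ x, lam * (‖P₁ x‖ ^ 2 - inner ℝ (P₁ m) (P₁ x) ^ 2) ≤ ‖P₂ x‖ ^ 2)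
    {κ : ℝ} (hκ : -lam < κ) (hκ0 : κ ≠ 0) (g : H₁) :
    ∃ x, ∀ y, inner ℝ (P₂ x) (P₂ y) + κ * inner ℝ (P₁ x) (P₁ y) = -inner ℝ g (P₁ y) := by
  -- The gap gives no control along `m`, and `κ` may be negative. The rank one term of size `τ`
  -- restores coercivity in that direction.
  set τ : ℝ := lam + |κ| with hτ
  set B : V →L[ℝ] V →L[ℝ] ℝ :=
    (isBoundedBilinearMap_inner (𝕜 := ℝ) (E := H₂)).toContinuousLinearMap.bilinearComp P₂ P₂ +
    κ • (isBoundedBilinearMap_inner (𝕜 := ℝ) (E := H₁)).toContinuousLinearMap.bilinearComp P₁ P₁ +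
    τ • ((innerSL ℝ (P₁ m)).comp P₁).smulRight ((innerSL ℝ (P₁ m)).comp P₁) with hB
  have hBapp : ∀ x y, B x y = inner ℝ (P₂ x) (P₂ y) + κ * inner ℝ (P₁ x) (P₁ y) +
      τ * (inner ℝ (P₁ m) (P₁ x) * inner ℝ (P₁ m) (P₁ y)) := fun x y => by
    simp [hB, IsBoundedBilinearMap.toContinuousLinearMap_apply]
  have hcoer : IsCoercive B := by
    -- A fraction `1 - θ` of `‖P₂ x‖²` is spent on the gap inequality and `θ` is kept. The choice of
    -- `θ` leaves at least `(lam + κ) / 2` in front of `‖P₁ x‖²`.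
    set θ : ℝ := min 1 ((lam + κ) / (2 * lam)) with hθ
    have hθpos : 0 < θ := lt_min one_pos (div_pos (by linarith) (by linarith))
    have hθ1 : θ ≤ 1 := min_le_left _ _
    have hθ2 : θ * lam ≤ (lam + κ) / 2 := by
      have := min_le_right 1 ((lam + κ) / (2 * lam))
      calc θ * lam ≤ (lam + κ) / (2 * lam) * lam := by gcongr
        _ = _ := by field_simp
    refine ⟨min θ ((lam + κ) / 2), lt_min hθpos (by linarith), fun x => ?_⟩
    rw [hBapp, real_inner_self_eq_norm_sq, real_inner_self_eq_norm_sq, mul_assoc, ← sq, ← sq, hV]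
    have h1 := hgap x
    have h2 : 0 ≤ inner ℝ (P₁ m) (P₁ x) ^ 2 := sq_nonneg _
    have h3 : min θ ((lam + κ) / 2) * ‖P₁ x‖ ^ 2 ≤ (lam + κ) / 2 * ‖P₁ x‖ ^ 2 :=
      mul_le_mul_of_nonneg_right (min_le_right _ _) (sq_nonneg _)
    have h4 : min θ ((lam + κ) / 2) * ‖P₂ x‖ ^ 2 ≤ θ * ‖P₂ x‖ ^ 2 :=
      mul_le_mul_of_nonneg_right (min_le_left _ _) (sq_nonneg _)
    have h5 : (1 - θ) * (lam * (‖P₁ x‖ ^ 2 - inner ℝ (P₁ m) (P₁ x) ^ 2)) ≤ (1 - θ) * ‖P₂ x‖ ^ 2 :=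
      mul_le_mul_of_nonneg_left h1 (by linarith)
    have h6 : θ * lam * ‖P₁ x‖ ^ 2 ≤ (lam + κ) / 2 * ‖P₁ x‖ ^ 2 :=
      mul_le_mul_of_nonneg_right hθ2 (sq_nonneg _)
    have h7 : 0 ≤ (|κ| + θ * lam) * inner ℝ (P₁ m) (P₁ x) ^ 2 := by positivity
    rw [hτ]
    nlinarith
  -- The right side is corrected along `m` so that it cancels the rank one term. Testing with `m`
  -- shows `κ ⟪m, x⟫ = -⟪g, m⟫`, that is `τ ⟪m, x⟫ = c`. Dividing by `κ` is where `κ ≠ 0` enters.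
  set c : ℝ := -(τ * inner ℝ g (P₁ m)) / κ with hc
  set u : V := ContinuousLinearMap.adjoint P₁ (-g + c • P₁ m) with hu
  obtain ⟨x, hx⟩ := hcoer.continuousLinearEquivOfBilin.surjective u
  have hBx : ∀ y, B x y = -inner ℝ g (P₁ y) + c * inner ℝ (P₁ m) (P₁ y) := fun y => by
    rw [← hcoer.continuousLinearEquivOfBilin_apply, hx, hu, ContinuousLinearMap.adjoint_inner_left,
      inner_add_left, inner_neg_left, real_inner_smul_left]
  have hρ := hBx m
  rw [hBapp, hm₂, inner_zero_right, real_inner_self_eq_norm_sq, hm₁, real_inner_comm] at hρ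
  have hκτ : κ + τ ≠ 0 := by
    have := neg_abs_le κ
    rw [hτ]
    intro h
    linarith
  have hρ' : κ * inner ℝ (P₁ m) (P₁ x) = -inner ℝ g (P₁ m) := by
    have h1 : (κ + τ) * (κ * inner ℝ (P₁ m) (P₁ x) + inner ℝ g (P₁ m)) = 0 := by
      have h2 : c * κ = -(τ * inner ℝ g (P₁ m)) := by rw [hc]; field_simp
      linear_combination κ * hρ + h2
    rcases mul_eq_zero.1 h1 with h | h
    · exact absurd h hκτ
    · linarith
  have hτc : τ * inner ℝ (P₁ m) (P₁ x) = c := by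
    rw [hc, eq_div_iff hκ0]
    linear_combination τ * hρ'
  refine ⟨x, fun y => ?_⟩
  have h1 := hBx y
  rw [hBapp] at h1
  linear_combination h1 - hτc * inner ℝ (P₁ m) (P₁ y)

/-- A priori bound for the solutions of the resolvent equation. -/
theorem norm_sq_resolvent_solution_le {V H₁ H₂ : Type*} [NormedAddCommGroup V] [InnerProductSpace ℝ V]
    [NormedAddCommGroup H₁] [InnerProductSpace ℝ H₁] [NormedAddCommGroup H₂]
    [InnerProductSpace ℝ H₂] (P₁ : V →L[ℝ] H₁) (P₂ : V →L[ℝ] H₂)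
    {m : V} (hm₁ : ‖P₁ m‖ = 1) (hm₂ : P₂ m = 0)
    {lam : ℝ} (hlam : 0 < lam)
    (hgap : ∀ x, lam * (‖P₁ x‖ ^ 2 - inner ℝ (P₁ m) (P₁ x) ^ 2) ≤ ‖P₂ x‖ ^ 2)
    {κ : ℝ} (hκ : -lam < κ) (hκ0 : κ ≠ 0) {g : H₁} {x : V}
    (hx : ∀ y, inner ℝ (P₂ x) (P₂ y) + κ * inner ℝ (P₁ x) (P₁ y) = -inner ℝ g (P₁ y)) :
    ‖P₁ x‖ ^ 2 ≤ 2 / (lam + κ) * (1 / (2 * (lam + κ)) + lam / κ ^ 2) * ‖g‖ ^ 2 := by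
  have hμ : 0 < lam + κ := by linarith
  -- Testing with `m` bounds the component along `m` by `‖g‖ / |κ|`. Testing with `x`, with the gap
  -- inequality, bounds the rest.
  have h1 := hx m
  rw [hm₂, inner_zero_right, zero_add, real_inner_comm] at h1
  have h2 := hx x
  rw [real_inner_self_eq_norm_sq, real_inner_self_eq_norm_sq] at h2
  have h3 := hgap x
  have h4 : inner ℝ (P₁ m) (P₁ x) ^ 2 ≤ ‖g‖ ^ 2 / κ ^ 2 := by
    rw [le_div_iff₀ (by positivity), mul_comm, ← mul_pow, h1, neg_sq, ← sq_abs]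
    have := abs_real_inner_le_norm g (P₁ m)
    rw [hm₁, mul_one] at this
    gcongr
  have h5 : -inner ℝ g (P₁ x) ≤ ‖g‖ * ‖P₁ x‖ :=
    (neg_le_abs _).trans (abs_real_inner_le_norm g (P₁ x))
  have h6 : ‖g‖ * ‖P₁ x‖ ≤ (lam + κ) / 2 * ‖P₁ x‖ ^ 2 + 1 / (2 * (lam + κ)) * ‖g‖ ^ 2 := by
    have h7 : 0 ≤ ((lam + κ) * ‖P₁ x‖ - ‖g‖) ^ 2 / (2 * (lam + κ)) := by positivity
    have h8 : ((lam + κ) * ‖P₁ x‖ - ‖g‖) ^ 2 / (2 * (lam + κ)) =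
      (lam + κ) / 2 * ‖P₁ x‖ ^ 2 + 1 / (2 * (lam + κ)) * ‖g‖ ^ 2 - ‖g‖ * ‖P₁ x‖ := by
      field_simp
      ring
    linarith
  have h9 : lam * inner ℝ (P₁ m) (P₁ x) ^ 2 ≤ lam / κ ^ 2 * ‖g‖ ^ 2 := by
    calc _ ≤ lam * (‖g‖ ^ 2 / κ ^ 2) := by gcongr
      _ = _ := by ring
  have h10 : (lam + κ) / 2 * ‖P₁ x‖ ^ 2 ≤ (1 / (2 * (lam + κ)) + lam / κ ^ 2) * ‖g‖ ^ 2 := by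
    nlinarith
  calc ‖P₁ x‖ ^ 2 = 2 / (lam + κ) * ((lam + κ) / 2 * ‖P₁ x‖ ^ 2) := by field_simp
    _ ≤ 2 / (lam + κ) * ((1 / (2 * (lam + κ)) + lam / κ ^ 2) * ‖g‖ ^ 2) := by gcongr
    _ = _ := by ring

/-! ### Hilbert space realisation of the form -/

/-- The measure `M⁻¹ dv`. -/
noncomputable def velMeasure (d : ℕ) : Measure (Vel d) :=
  volume.withDensity fun v => ENNReal.ofReal (maxwellian v)⁻¹

/-- The measure `B M M_* dv dv_* dσ / 2`. -/
noncomputable def incMeasure {d : ℕ} (γ : ℝ) (b : ℝ → ℝ) : Measure (Vel d × Vel d × Sph d) :=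
  (collMeasure d).withDensity fun p => ENNReal.ofReal (collWeight γ b p / 2)

theorem measurable_inv_maxwellian {d : ℕ} :
    Measurable fun v : Vel d => ENNReal.ofReal (maxwellian v)⁻¹ :=
  continuous_maxwellian.measurable.inv.ennreal_ofReal

theorem measurable_collWeight {d : ℕ} (γ : ℝ) {b : ℝ → ℝ} (hb : Measurable b) :
    Measurable (collWeight γ b : Vel d × Vel d × Sph d → ℝ) := by
  unfold collWeight kernelB
  refine Measurable.mul (Measurable.mul (Measurable.mul ?_ (hb.comp measurable_cosTheta))
    (continuous_maxwellian.measurable.comp measurable_fst))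
    (continuous_maxwellian.measurable.comp (measurable_fst.comp measurable_snd))
  fun_prop

theorem velMeasure_ac {d : ℕ} : velMeasure d ≪ volume := withDensity_absolutelyContinuous _ _

theorem volume_ac_velMeasure {d : ℕ} : (volume : Measure (Vel d)) ≪ velMeasure d :=
  withDensity_absolutelyContinuous' measurable_inv_maxwellian.aemeasurable
    (Filter.Eventually.of_forall fun v =>
      (ENNReal.ofReal_pos.2 (inv_pos.2 (maxwellian_pos v))).ne')

theorem incMeasure_ac {d : ℕ} (γ : ℝ) (b : ℝ → ℝ) :
    (incMeasure γ b : Measure (Vel d × Vel d × Sph d)) ≪ collMeasure d :=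
  withDensity_absolutelyContinuous _ _

theorem integrable_velMeasure {d : ℕ} {f : Vel d → ℝ} :
    Integrable f (velMeasure d) ↔ Integrable (fun v => f v / maxwellian v) := by
  rw [velMeasure, integrable_withDensity_iff_integrable_smul' measurable_inv_maxwellian
    (Filter.Eventually.of_forall fun v => ENNReal.ofReal_lt_top)]
  refine integrable_congr (Filter.Eventually.of_forall fun v => ?_)
  simp only
  rw [ENNReal.toReal_ofReal (inv_nonneg.2 (maxwellian_pos v).le), smul_eq_mul, div_eq_inv_mul]

theorem integral_velMeasure {d : ℕ} (f : Vel d → ℝ) :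
    ∫ v, f v ∂(velMeasure d) = ∫ v, f v / maxwellian v := by
  rw [velMeasure, integral_withDensity_eq_integral_toReal_smul measurable_inv_maxwellian
    (Filter.Eventually.of_forall fun v => ENNReal.ofReal_lt_top)]
  refine integral_congr_ae (Filter.Eventually.of_forall fun v => ?_)
  simp only
  rw [ENNReal.toReal_ofReal (inv_nonneg.2 (maxwellian_pos v).le), smul_eq_mul, div_eq_inv_mul]

theorem collWeight_mul_sq_nonneg {d : ℕ} {γ : ℝ} {b : ℝ → ℝ}
    (hb0 : ∀ x, -1 ≤ x → x < 1 → 0 ≤ b x) (f : Vel d → ℝ) (p : Vel d × Vel d × Sph d) :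
    0 ≤ collWeight γ b p * increment f p ^ 2 := by
  have h := mul_increment_sq_le (γ := γ) (b := b) (C := 1) (g := 0) (p := p) (fun _ hx => ?_) f
  · simpa using h
  · have h1 := hb0 _ (abs_le.1 (abs_cosTheta_le p.1 p.2.1 p.2.2)).1 hx
    have h2 := maxwellian_pos p.1
    have h3 := maxwellian_pos p.2.1
    rw [collWeight, kernelB]
    positivity

/-- Nothing is assumed on the sign of `b` at `1`, so the weight may be negative there. The increment
vanishes wherever it is, and truncating the density at `0` loses nothing. -/
theorem toReal_collWeight_mul {d : ℕ} {γ : ℝ} {b : ℝ → ℝ}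
    (hb0 : ∀ x, -1 ≤ x → x < 1 → 0 ≤ b x) (f φ : Vel d → ℝ) (p : Vel d × Vel d × Sph d) :
    (ENNReal.ofReal (collWeight γ b p / 2)).toReal • (increment f p * increment φ p) =
      1 / 2 * (collWeight γ b p * increment f p * increment φ p) := by
  rcases le_or_gt 0 (collWeight γ b p) with h | h
  · rw [ENNReal.toReal_ofReal (by positivity), smul_eq_mul]
    ring
  · have h1 := collWeight_mul_sq_nonneg (γ := γ) hb0 f p
    have h2 : increment f p = 0 := by
      by_contra h3
      have : 0 < increment f p ^ 2 := by positivity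
      nlinarith
    simp [h2]

theorem memL2_iff {d : ℕ} {f : Vel d → ℝ} : MemL2 f ↔ MemLp f 2 (velMeasure d) := by
  have key : AEStronglyMeasurable f volume → (sqNorm 0 f < ⊤ ↔ MemLp f 2 (velMeasure d)) := by
    intro hf
    rw [memLp_two_iff_integrable_sq (hf.mono_ac velMeasure_ac), integrable_velMeasure,
      ← lintegral_ofReal_ne_top_iff_integrable, lt_top_iff_ne_top, sqNorm]
    · simp
    · exact ((hf.pow 2).aemeasurable.div
        continuous_maxwellian.measurable.aemeasurable).aestronglyMeasurable
    · exact Filter.Eventually.of_forall fun v => by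
        have := maxwellian_pos v
        change 0 ≤ f v ^ 2 / maxwellian v
        positivity
  constructor
  · exact fun h => (key h.1).1 h.2
  · intro h
    have h1 := h.1.mono_ac volume_ac_velMeasure
    exact ⟨h1, (key h1).2 h⟩

theorem innerL2_eq {d : ℕ} {f g : Vel d → ℝ} (hf : MemLp f 2 (velMeasure d))
    (hg : MemLp g 2 (velMeasure d)) : innerL2 f g = inner ℝ (hf.toLp f) (hg.toLp g) := by
  rw [L2.inner_def, innerL2, ← integral_velMeasure fun v => f v * g v]
  refine integral_congr_ae ?_
  filter_upwards [hf.coeFn_toLp, hg.coeFn_toLp] with v h1 h2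
  rw [h1, h2]
  simp [mul_comm]

theorem sqNorm_zero_eq {d : ℕ} {f : Vel d → ℝ} (hf : MemLp f 2 (velMeasure d)) :
    sqNorm 0 f = ENNReal.ofReal (‖hf.toLp f‖ ^ 2) := by
  rw [← real_inner_self_eq_norm_sq, ← innerL2_eq hf hf, innerL2,
    ofReal_integral_eq_lintegral_ofReal]
  · refine lintegral_congr fun v => ?_
    rw [Real.rpow_zero, mul_one, sq]
  · simpa [sq] using integrable_velMeasure.1 hf.integrable_sq
  · exact Filter.Eventually.of_forall fun v => by
      have := maxwellian_pos v
      exact div_nonneg (mul_self_nonneg _) this.le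

theorem aestronglyMeasurable_increment {d : ℕ} (hd : 2 ≤ d) {f : Vel d → ℝ}
    (hf : AEStronglyMeasurable f volume) : AEStronglyMeasurable (increment f) (collMeasure d) := by
  have h : AEStronglyMeasurable (fun v => f v / maxwellian v) volume :=
    (hf.aemeasurable.div continuous_maxwellian.measurable.aemeasurable).aestronglyMeasurable
  exact (h.comp_quasiMeasurePreserving quasiMeasurePreserving_fst).sub
    (h.comp_quasiMeasurePreserving (quasiMeasurePreserving_vPrime hd))

theorem integrable_incMeasure {d : ℕ} {γ : ℝ} {b : ℝ → ℝ} (hb : Measurable b)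
    (hb0 : ∀ x, -1 ≤ x → x < 1 → 0 ≤ b x) {f φ : Vel d → ℝ} :
    Integrable (fun p => increment f p * increment φ p) (incMeasure γ b) ↔
      Integrable (fun p => 1 / 2 * (collWeight γ b p * increment f p * increment φ p))
        (collMeasure d) := by
  rw [incMeasure, integrable_withDensity_iff_integrable_smul'
    ((measurable_collWeight γ hb).div_const 2).ennreal_ofReal
    (Filter.Eventually.of_forall fun v => ENNReal.ofReal_lt_top)]
  simp_rw [toReal_collWeight_mul hb0]

theorem dirichlet_eq_lintegral {d : ℕ} (γ : ℝ) (b : ℝ → ℝ) (f : Vel d → ℝ) :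
    dirichlet γ b f = ∫⁻ p, ENNReal.ofReal (1 / 2 * (collWeight γ b p * increment f p *
      increment f p)) ∂(collMeasure d) := by
  simp_rw [ENNReal.ofReal_mul (show (0 : ℝ) ≤ 1 / 2 by norm_num)]
  rw [lintegral_const_mul' _ _ ENNReal.ofReal_ne_top, dirichlet]
  congr 1
  · simp
  · simp_rw [mul_assoc, sq]

theorem dirichlet_lt_top_iff {d : ℕ} (hd : 2 ≤ d) {γ : ℝ} {b : ℝ → ℝ} (hb : Measurable b)
    (hb0 : ∀ x, -1 ≤ x → x < 1 → 0 ≤ b x) {f : Vel d → ℝ} (hf : AEStronglyMeasurable f volume) :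
    dirichlet γ b f < ⊤ ↔ MemLp (increment f) 2 (incMeasure γ b) := by
  have hm := aestronglyMeasurable_increment hd hf
  rw [memLp_two_iff_integrable_sq (hm.mono_ac (incMeasure_ac γ b))]
  simp_rw [sq]
  rw [integrable_incMeasure hb hb0, ← lintegral_ofReal_ne_top_iff_integrable, lt_top_iff_ne_top,
    dirichlet_eq_lintegral]
  · exact (((measurable_collWeight γ hb).aestronglyMeasurable.mul hm).mul hm).const_mul _
  · refine Filter.Eventually.of_forall fun p => ?_
    have := collWeight_mul_sq_nonneg (γ := γ) hb0 f p
    change 0 ≤ 1 / 2 * (collWeight γ b p * increment f p * increment f p)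
    rw [mul_assoc, ← sq]
    positivity

theorem dirichletBilin_eq {d : ℕ} {γ : ℝ} {b : ℝ → ℝ} (hb : Measurable b)
    (hb0 : ∀ x, -1 ≤ x → x < 1 → 0 ≤ b x) {f φ : Vel d → ℝ}
    (hf : MemLp (increment f) 2 (incMeasure γ b)) (hφ : MemLp (increment φ) 2 (incMeasure γ b)) :
    dirichletBilin γ b f φ = inner ℝ (hf.toLp _) (hφ.toLp _) := by
  rw [L2.inner_def, dirichletBilin, ← integral_const_mul]
  simp_rw [← toReal_collWeight_mul hb0]
  rw [← integral_withDensity_eq_integral_toReal_smul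
    ((measurable_collWeight γ hb).div_const 2).ennreal_ofReal
    (Filter.Eventually.of_forall fun v => ENNReal.ofReal_lt_top)]
  refine integral_congr_ae ?_
  filter_upwards [hf.coeFn_toLp, hφ.coeFn_toLp] with v h1 h2
  rw [h1, h2]
  simp [mul_comm]

theorem dirichlet_eq {d : ℕ} {γ : ℝ} {b : ℝ → ℝ} (hb : Measurable b)
    (hb0 : ∀ x, -1 ≤ x → x < 1 → 0 ≤ b x) {f : Vel d → ℝ}
    (hf : MemLp (increment f) 2 (incMeasure γ b)) :
    dirichlet γ b f = ENNReal.ofReal (‖hf.toLp _‖ ^ 2) := by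
  rw [← real_inner_self_eq_norm_sq, ← dirichletBilin_eq hb hb0 hf hf, dirichletBilin,
    ← integral_const_mul, ofReal_integral_eq_lintegral_ofReal, dirichlet_eq_lintegral]
  · have := hf.integrable_sq
    simp_rw [sq] at this
    exact (integrable_incMeasure hb hb0).1 this
  · refine Filter.Eventually.of_forall fun p => ?_
    have := collWeight_mul_sq_nonneg (γ := γ) hb0 f p
    change 0 ≤ 1 / 2 * (collWeight γ b p * increment f p * increment f p)
    rw [mul_assoc, ← sq]
    positivity

/-- The form domain as a subspace of `L²(M⁻¹) × L²(B M M_* / 2)`: pairs of a function and its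
increment. -/
noncomputable def formSpace {d : ℕ} (hd : 2 ≤ d) (γ : ℝ) (b : ℝ → ℝ) :
    Submodule ℝ (WithLp 2 (Lp ℝ 2 (velMeasure d) × Lp ℝ 2 (incMeasure (d := d) γ b))) where
  carrier := {x | (x.snd : Vel d × Vel d × Sph d → ℝ) =ᵐ[incMeasure γ b] increment (x.fst : Vel d → ℝ)}
  add_mem' {x y} hx hy := by
    have h1 := (incMeasure_ac γ b).ae_le (increment_congr_ae hd
      (volume_ac_velMeasure.ae_le (Lp.coeFn_add x.fst y.fst)))
    have h2 := Lp.coeFn_add x.snd y.snd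
    change (⇑(x + y).snd) =ᵐ[incMeasure γ b] increment ⇑(x + y).fst
    rw [WithLp.add_snd, WithLp.add_fst]
    filter_upwards [h1, h2, hx, hy] with p h1 h2 hx hy
    rw [h1, h2, Pi.add_apply, hx, hy]
    simp only [increment, Pi.add_apply]
    ring
  zero_mem' := by
    have h1 := (incMeasure_ac γ b).ae_le (increment_congr_ae hd
      (volume_ac_velMeasure.ae_le (Lp.coeFn_zero ℝ 2 (velMeasure d))))
    have h2 := Lp.coeFn_zero ℝ 2 (incMeasure (d := d) γ b)
    change (⇑(0 : Lp ℝ 2 (incMeasure (d := d) γ b))) =ᵐ[incMeasure γ b]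
      increment ⇑(0 : Lp ℝ 2 (velMeasure d))
    filter_upwards [h1, h2] with p h1 h2
    rw [h1, h2]
    simp [increment]
  smul_mem' c x hx := by
    have h1 := (incMeasure_ac γ b).ae_le (increment_congr_ae hd
      (volume_ac_velMeasure.ae_le (Lp.coeFn_smul c x.fst)))
    have h2 := Lp.coeFn_smul c x.snd
    change (⇑(c • x).snd) =ᵐ[incMeasure γ b] increment ⇑(c • x).fst
    rw [WithLp.smul_snd, WithLp.smul_fst]
    filter_upwards [h1, h2, hx] with p h1 h2 hx
    rw [h1, h2, Pi.smul_apply, hx]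
    simp only [increment, Pi.smul_apply, smul_eq_mul]
    ring

theorem mem_formSpace {d : ℕ} (hd : 2 ≤ d) {γ : ℝ} {b : ℝ → ℝ}
    {x : WithLp 2 (Lp ℝ 2 (velMeasure d) × Lp ℝ 2 (incMeasure (d := d) γ b))} :
    x ∈ formSpace hd γ b ↔
      (x.snd : Vel d × Vel d × Sph d → ℝ) =ᵐ[incMeasure γ b] increment (x.fst : Vel d → ℝ) :=
  Iff.rfl

/-- The Dirichlet form is closed. -/
theorem isClosed_formSpace {d : ℕ} (hd : 2 ≤ d) (γ : ℝ) (b : ℝ → ℝ) :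
    IsClosed (formSpace (d := d) hd γ b : Set (WithLp 2 (Lp ℝ 2 (velMeasure d) ×
      Lp ℝ 2 (incMeasure (d := d) γ b)))) := by
  refine IsSeqClosed.isClosed fun x y hx hxy => ?_
  have h1 : Filter.Tendsto (fun n => (x n).fst) Filter.atTop (nhds y.fst) :=
    ((WithLp.continuous_fst 2 _ _).tendsto y).comp hxy
  -- Almost everywhere convergence along a subsequence pulls back through both `v` and `v'`, which
  -- are non-singular maps. The increments thus converge to the increment of the limit, which
  -- identifies the second component.
  obtain ⟨ns, hns, hae1⟩ := (tendstoInMeasure_of_tendsto_Lp h1).exists_seq_tendsto_ae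
  have h2 : Filter.Tendsto (fun n => (x (ns n)).snd) Filter.atTop (nhds y.snd) :=
    (((WithLp.continuous_snd 2 _ _).tendsto y).comp hxy).comp hns.tendsto_atTop
  obtain ⟨ms, hms, hae2⟩ := (tendstoInMeasure_of_tendsto_Lp h2).exists_seq_tendsto_ae
  have h3 := volume_ac_velMeasure.ae_le hae1
  have h4 := (incMeasure_ac γ b).ae_le (quasiMeasurePreserving_fst.ae h3)
  have h5 := (incMeasure_ac γ b).ae_le ((quasiMeasurePreserving_vPrime hd).ae h3)
  have h6 : ∀ᵐ p ∂(incMeasure (d := d) γ b), ∀ n, (x n).snd p = increment (⇑(x n).fst) p :=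
    ae_all_iff.2 fun n => hx n
  change (⇑y.snd) =ᵐ[incMeasure γ b] increment ⇑y.fst
  filter_upwards [hae2, h4, h5, h6] with p g2 g4 g5 g6
  refine tendsto_nhds_unique g2 ?_
  simp_rw [g6]
  exact ((g4.div_const _).sub (g5.div_const _)).comp hms.tendsto_atTop

/-! ### The Maxwellian as normalised ground state -/

theorem memLp_const_mul_maxwellian {d : ℕ} (c : ℝ) :
    MemLp (fun v : Vel d => c * maxwellian v) 2 (velMeasure d) := by
  refine MemLp.const_mul ?_ c
  rw [memLp_two_iff_integrable_sq continuous_maxwellian.aestronglyMeasurable, integrable_velMeasure]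
  refine integrable_maxwellian.congr (Filter.Eventually.of_forall fun v => ?_)
  have := (maxwellian_pos v).ne'
  simp only
  field_simp

theorem memLp_maxwellian {d : ℕ} : MemLp (maxwellian : Vel d → ℝ) 2 (velMeasure d) := by
  simpa using memLp_const_mul_maxwellian (d := d) 1

theorem increment_const_mul_maxwellian {d : ℕ} (c : ℝ) :
    increment (fun v : Vel d => c * maxwellian v) = 0 := by
  ext p
  have h1 := (maxwellian_pos p.1).ne'
  have h2 := (maxwellian_pos (vPrime p.1 p.2.1 p.2.2)).ne'
  simp only [increment, Pi.zero_apply]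
  field_simp
  ring

theorem increment_maxwellian {d : ℕ} : increment (maxwellian : Vel d → ℝ) = 0 := by
  simpa using increment_const_mul_maxwellian (d := d) 1

theorem innerL2_maxwellian {d : ℕ} (f : Vel d → ℝ) : innerL2 maxwellian f = mass f := by
  refine integral_congr_ae (Filter.Eventually.of_forall fun v => ?_)
  have := (maxwellian_pos v).ne'
  simp only
  field_simp

theorem norm_toLp_maxwellian {d : ℕ} : ‖(memLp_maxwellian (d := d)).toLp maxwellian‖ = 1 := by
  have h : ‖(memLp_maxwellian (d := d)).toLp maxwellian‖ ^ 2 = 1 := by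
    rw [← real_inner_self_eq_norm_sq, ← innerL2_eq, innerL2_maxwellian]
    exact integral_maxwellian
  exact (pow_eq_one_iff_of_nonneg (norm_nonneg _) two_ne_zero).1 h

theorem integrable_of_memLp {d : ℕ} {f : Vel d → ℝ} (hf : MemLp f 2 (velMeasure d)) :
    Integrable f := by
  refine (integrable_velMeasure.1 (hf.integrable_mul memLp_maxwellian)).congr
    (Filter.Eventually.of_forall fun v => ?_)
  have := (maxwellian_pos v).ne'
  simp only [Pi.mul_apply]
  field_simp

/-- The square of the distance to the equilibrium of the same mass. -/
theorem sqNorm_sub_mass_eq {d : ℕ} {f : Vel d → ℝ} (hf : MemLp f 2 (velMeasure d)) :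
    sqNorm 0 (fun v => f v - mass f * maxwellian v) = ENNReal.ofReal (‖hf.toLp f‖ ^ 2 -
      inner ℝ (memLp_maxwellian.toLp maxwellian) (hf.toLp f) ^ 2) := by
  have h1 : MemLp (f - mass f • maxwellian) 2 (velMeasure d) :=
    hf.sub (memLp_maxwellian.const_smul (mass f))
  have h2 := sqNorm_zero_eq h1
  have h3 : h1.toLp _ = hf.toLp f - mass f • memLp_maxwellian.toLp maxwellian := by
    rw [MemLp.toLp_sub hf (memLp_maxwellian.const_smul (mass f)), MemLp.toLp_const_smul]
  rw [h3, norm_sub_sq_real, norm_smul, norm_toLp_maxwellian, inner_smul_right, real_inner_comm,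
    ← innerL2_eq, innerL2_maxwellian, mul_one, Real.norm_eq_abs, sq_abs] at h2
  rw [← innerL2_eq, innerL2_maxwellian]
  refine h2.trans ?_
  congr 1
  ring

theorem sub_inner_sq_le {d : ℕ} {γ : ℝ} {b : ℝ → ℝ} (hb : Measurable b)
    (hb0 : ∀ x, -1 ≤ x → x < 1 → 0 ≤ b x) {lam : ℝ} (hlam : 0 < lam)
    (hgap : ∀ f : Vel d → ℝ, Integrable f →
      ENNReal.ofReal lam * sqNorm 0 (fun v => f v - mass f * maxwellian v) ≤ dirichlet γ b f)
    {f : Vel d → ℝ} (hf : MemLp f 2 (velMeasure d))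
    (hf' : MemLp (increment f) 2 (incMeasure γ b)) :
    lam * (‖hf.toLp f‖ ^ 2 - inner ℝ (memLp_maxwellian.toLp maxwellian) (hf.toLp f) ^ 2) ≤
      ‖hf'.toLp (increment f)‖ ^ 2 := by
  have h := hgap f (integrable_of_memLp hf)
  rw [sqNorm_sub_mass_eq hf, dirichlet_eq hb hb0 hf', ← ENNReal.ofReal_mul hlam.le,
    ENNReal.ofReal_le_ofReal_iff (sq_nonneg _)] at h
  exact h

theorem memForm_iff {d : ℕ} (hd : 2 ≤ d) {γ : ℝ} {b : ℝ → ℝ} (hb : Measurable b)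
    (hb0 : ∀ x, -1 ≤ x → x < 1 → 0 ≤ b x) {f : Vel d → ℝ} :
    MemForm γ b f ↔ MemLp f 2 (velMeasure d) ∧ MemLp (increment f) 2 (incMeasure γ b) := by
  rw [MemForm, ← memL2_iff]
  exact and_congr_right fun h => dirichlet_lt_top_iff hd hb hb0 h.1

/-- The element of the form space given by a function of the form domain. -/
noncomputable def toFormSpace {d : ℕ} (hd : 2 ≤ d) {γ : ℝ} {b : ℝ → ℝ} {f : Vel d → ℝ}
    (hf : MemLp f 2 (velMeasure d)) (hf' : MemLp (increment f) 2 (incMeasure γ b)) :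
    formSpace (d := d) hd γ b :=
  ⟨WithLp.toLp 2 (hf.toLp f, hf'.toLp (increment f)), by
    rw [mem_formSpace]
    filter_upwards [hf'.coeFn_toLp, (incMeasure_ac γ b).ae_le (increment_congr_ae hd
      (volume_ac_velMeasure.ae_le hf.coeFn_toLp))] with p h1 h2
    rw [WithLp.toLp_snd, WithLp.toLp_fst, h1, h2]⟩

/-- The two components of an element of the form space. -/
theorem exists_eq_toFormSpace {d : ℕ} (hd : 2 ≤ d) {γ : ℝ} {b : ℝ → ℝ}
    (x : formSpace (d := d) hd γ b) :
    ∃ (f : Vel d → ℝ) (hf : MemLp f 2 (velMeasure d))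
      (hf' : MemLp (increment f) 2 (incMeasure γ b)), x = toFormSpace hd hf hf' := by
  have hx := (mem_formSpace hd).1 x.2
  have hf := Lp.memLp x.1.fst
  have hf' := (Lp.memLp x.1.snd).ae_eq hx
  refine ⟨_, hf, hf', Subtype.ext ?_⟩
  have h1 : hf.toLp _ = x.1.fst := Lp.toLp_coeFn _ _
  have h2 : hf'.toLp _ = x.1.snd := by
    refine Lp.ext (hf'.coeFn_toLp.trans hx.symm)
  change x.1 = WithLp.toLp 2 (hf.toLp _, hf'.toLp _)
  rw [h1, h2]
  rfl

/-! ### From the Poincaré inequality to the spectral gap -/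

/-- A Poincaré inequality for the Dirichlet form implies the spectral gap. -/
theorem hasSpectralGap_of_poincare {d : ℕ} (hd : 2 ≤ d) {γ : ℝ} {b : ℝ → ℝ} (hb : Measurable b)
    (hb0 : ∀ x, -1 ≤ x → x < 1 → 0 ≤ b x) {lam : ℝ} (hlam : 0 < lam)
    (hgap : ∀ f : Vel d → ℝ, Integrable f →
      ENNReal.ofReal lam * sqNorm 0 (fun v => f v - mass f * maxwellian v) ≤ dirichlet γ b f) :
    HasSpectralGap d γ b lam := by
  have : CompleteSpace (formSpace (d := d) hd γ b) := (isClosed_formSpace hd γ b).completeSpace_coe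
  set P₁ : formSpace (d := d) hd γ b →L[ℝ] Lp ℝ 2 (velMeasure d) :=
    (WithLp.fstL 2 ℝ _ _).comp (formSpace (d := d) hd γ b).subtypeL with hP₁
  set P₂ : formSpace (d := d) hd γ b →L[ℝ] Lp ℝ 2 (incMeasure (d := d) γ b) :=
    (WithLp.sndL 2 ℝ _ _).comp (formSpace (d := d) hd γ b).subtypeL with hP₂
  have hV : ∀ x, ‖x‖ ^ 2 = ‖P₁ x‖ ^ 2 + ‖P₂ x‖ ^ 2 := fun x =>
    WithLp.prod_norm_sq_eq_of_L2 x.1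
  have hM' : MemLp (increment maxwellian) 2 (incMeasure (d := d) γ b) := by
    rw [increment_maxwellian]; exact MemLp.zero
  set m := toFormSpace hd (memLp_maxwellian (d := d)) hM' with hm
  have hP₁m : P₁ m = memLp_maxwellian.toLp maxwellian := rfl
  have hm₁ : ‖P₁ m‖ = 1 := norm_toLp_maxwellian
  have hm₂ : P₂ m = 0 := by
    change hM'.toLp _ = 0
    refine Lp.ext (hM'.coeFn_toLp.trans ?_)
    rw [increment_maxwellian]
    exact (Lp.coeFn_zero _ _ _).symm
  have hgap' : ∀ x, lam * (‖P₁ x‖ ^ 2 - inner ℝ (P₁ m) (P₁ x) ^ 2) ≤ ‖P₂ x‖ ^ 2 := fun x => by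
    obtain ⟨f, hf, hf', rfl⟩ := exists_eq_toFormSpace hd x
    exact sub_inner_sq_le hb hb0 hlam hgap hf hf'
  have hcomb : ∀ {f g : Vel d → ℝ} (κ : ℝ) (hf : MemLp f 2 (velMeasure d))
      (hg : MemLp g 2 (velMeasure d)) (hgf : MemLp (fun v => g v + κ * f v) 2 (velMeasure d)),
      hgf.toLp _ = hg.toLp g + κ • hf.toLp f := by
    intro f g κ hf hg hgf
    rw [← MemLp.toLp_const_smul, ← MemLp.toLp_add]
    rfl
  refine ⟨fun f => ⟨fun h => ?_, fun h => ?_⟩, fun κ hκ hκ0 => ⟨fun g hg => ?_, ?_⟩⟩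
  · obtain ⟨hf, -, hφ⟩ := h
    -- Testing the equation with `f` itself gives `𝔻(f) = 0`, and the Poincaré inequality identifies
    -- `f` with its projection on the Maxwellian.
    have h0 := hφ f hf
    obtain ⟨hf1, hf2⟩ := (memForm_iff hd hb hb0).1 hf
    rw [dirichletBilin_eq hb hb0 hf2 hf2, real_inner_self_eq_norm_sq] at h0
    have h1 : ‖hf2.toLp (increment f)‖ ^ 2 = 0 := by
      have : innerL2 (fun _ => 0) f = 0 := by simp [innerL2]
      linarith
    have h2 := hgap f (integrable_of_memLp hf1)
    rw [dirichlet_eq hb hb0 hf2, h1, ENNReal.ofReal_zero, nonpos_iff_eq_zero, mul_eq_zero] at h2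
    have h3 : sqNorm 0 (fun v => f v - mass f * maxwellian v) = 0 :=
      h2.resolve_left (ENNReal.ofReal_pos.2 hlam).ne'
    refine ⟨mass f, ?_⟩
    have hfm : AEMeasurable f := hf.1.1.aemeasurable
    rw [sqNorm, lintegral_eq_zero_iff'] at h3
    · filter_upwards [h3] with v hv
      simp only [Real.rpow_zero, mul_one, Pi.zero_apply, ENNReal.ofReal_eq_zero] at hv
      have h4 : 0 ≤ (f v - mass f * maxwellian v) ^ 2 / maxwellian v :=
        div_nonneg (sq_nonneg _) (maxwellian_pos v).le
      have h5 := (div_eq_zero_iff.1 (le_antisymm hv h4)).resolve_right (maxwellian_pos v).ne'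
      exact sub_eq_zero.1 (pow_eq_zero_iff two_ne_zero |>.1 h5)
    · exact ((((hfm.sub (continuous_maxwellian.measurable.const_mul _).aemeasurable).pow_const 2).mul
        (measurable_bracket_rpow 0).aemeasurable).div
        continuous_maxwellian.measurable.aemeasurable).ennreal_ofReal
  · obtain ⟨c, hc⟩ := h
    have hc1 : MemLp f 2 (velMeasure d) :=
      (memLp_const_mul_maxwellian c).ae_eq (velMeasure_ac.ae_le hc.symm)
    have hinc : increment f =ᵐ[collMeasure d] 0 := by
      have := increment_congr_ae hd hc
      rwa [increment_const_mul_maxwellian] at this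
    have hc2 : MemLp (increment f) 2 (incMeasure γ b) :=
      MemLp.zero.ae_eq ((incMeasure_ac γ b).ae_le hinc.symm)
    refine ⟨(memForm_iff hd hb hb0).2 ⟨hc1, hc2⟩, memL2_iff.2 MemLp.zero, fun φ _ => ?_⟩
    have h1 : dirichletBilin γ b f φ = 0 := by
      rw [dirichletBilin, integral_eq_zero_of_ae, mul_zero]
      filter_upwards [hinc] with p hp
      simp [hp]
    rw [h1]
    simp [innerL2]
  · have hg' := memL2_iff.1 hg
    obtain ⟨x, hx⟩ := exists_resolvent_solution P₁ P₂ hV hm₁ hm₂ hlam hgap' hκ hκ0 (hg'.toLp g)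
    obtain ⟨f, hf, hf', rfl⟩ := exists_eq_toFormSpace hd x
    have hgf : MemLp (fun v => g v + κ * f v) 2 (velMeasure d) := hg'.add (hf.const_mul κ)
    refine ⟨f, (memForm_iff hd hb hb0).2 ⟨hf, hf'⟩, memL2_iff.2 hgf, fun φ hφ => ?_⟩
    obtain ⟨hφ1, hφ2⟩ := (memForm_iff hd hb hb0).1 hφ
    have h1 := hx (toFormSpace hd hφ1 hφ2)
    change inner ℝ (hf'.toLp _) (hφ2.toLp _) + κ * inner ℝ (hf.toLp _) (hφ1.toLp _) =
      -inner ℝ (hg'.toLp g) (hφ1.toLp φ) at h1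
    rw [innerL2_eq hgf hφ1, hcomb κ hf hg' hgf, inner_add_left, real_inner_smul_left,
      dirichletBilin_eq hb hb0 hf' hφ2]
    linarith
  · set K : ℝ := 2 / (lam + κ) * (1 / (2 * (lam + κ)) + lam / κ ^ 2) with hK
    have hK0 : 0 ≤ K := by
      have : 0 < lam + κ := by linarith
      positivity
    refine ⟨K.toNNReal, fun f g hg hfg => ?_⟩
    obtain ⟨hf0, hgf0, hφ⟩ := hfg
    obtain ⟨hf, hf'⟩ := (memForm_iff hd hb hb0).1 hf0
    have hg' := memL2_iff.1 hg
    have hgf := memL2_iff.1 hgf0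
    have hx : ∀ y, inner ℝ (P₂ (toFormSpace hd hf hf')) (P₂ y) +
        κ * inner ℝ (P₁ (toFormSpace hd hf hf')) (P₁ y) = -inner ℝ (hg'.toLp g) (P₁ y) := by
      intro y
      obtain ⟨φ, hφ1, hφ2, rfl⟩ := exists_eq_toFormSpace hd y
      have h1 := hφ φ ((memForm_iff hd hb hb0).2 ⟨hφ1, hφ2⟩)
      rw [innerL2_eq hgf hφ1, hcomb κ hf hg' hgf, inner_add_left, real_inner_smul_left,
        dirichletBilin_eq hb hb0 hf' hφ2] at h1
      change inner ℝ (hf'.toLp _) (hφ2.toLp _) + κ * inner ℝ (hf.toLp _) (hφ1.toLp _) =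
        -inner ℝ (hg'.toLp g) (hφ1.toLp φ)
      linarith
    have h1 := norm_sq_resolvent_solution_le P₁ P₂ hm₁ hm₂ hlam hgap' hκ hκ0 hx
    rw [sqNorm_zero_eq hf, sqNorm_zero_eq hg']
    change _ ≤ ENNReal.ofReal K * _
    rw [← ENNReal.ofReal_mul hK0]
    exact ENNReal.ofReal_le_ofReal h1

end LinBoltz

/-! ### Conclusion -/

theorem proposition6p1 (d : ℕ) (hd : 2 ≤ d) (γ ν c₀ c₁ : ℝ)
    (hγ : γ ∈ Set.Ioo (-(d : ℝ)) 0) (hν : ν ∈ Set.Ioo (0 : ℝ) 2)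
    (hc₀ : 0 < c₀) (hc₁ : c₀ ≤ c₁) (b : ℝ → ℝ) (hb : Measurable b)
    (hbθ : ∀ θ ∈ Set.Ioc (0 : ℝ) Real.pi,
      c₀ * θ ^ (-((d : ℝ) - 1) - ν) ≤ b (Real.cos θ) ∧
      b (Real.cos θ) ≤ c₁ * θ ^ (-((d : ℝ) - 1) - ν)) :
    (∀ ε : ℝ, 0 < ε → ∃ C : ℝ, 0 < C ∧
      ∀ f : LinBoltz.Vel d → ℝ, MeasureTheory.Integrable f →
        ENNReal.ofReal C *
            LinBoltz.sqNorm (γ + ν - ε)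
              (fun v => f v - LinBoltz.mass f * LinBoltz.maxwellian v)
          ≤ LinBoltz.dirichlet γ b f) ∧
    (0 < γ + ν → ∃ lam : ℝ, 0 < lam ∧
      (∀ f : LinBoltz.Vel d → ℝ, MeasureTheory.Integrable f →
        ENNReal.ofReal lam *
            LinBoltz.sqNorm 0 (fun v => f v - LinBoltz.mass f * LinBoltz.maxwellian v)
          ≤ LinBoltz.dirichlet γ b f) ∧
      LinBoltz.HasSpectralGap d γ b lam) := by
  obtain ⟨c, hc, hbc⟩ := LinBoltz.exists_angular_lower_bound hd hν.1 hc₀ fun θ hθ => (hbθ θ hθ).1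
  obtain ⟨C, hC, hcoer⟩ := LinBoltz.exists_coercivity hd hγ.2 hν.1 hc hbc
  -- Since `⟨v⟩ ≥ 1`, the bound at exponent `γ + ν` implies it at every smaller exponent with the
  -- same constant: at `γ + ν - ε`, and at `0` when `γ + ν > 0`. That constant is also the size of
  -- the gap.
  have hmono : ∀ s ≤ γ + ν, ∀ f : LinBoltz.Vel d → ℝ, Integrable f →
      ENNReal.ofReal C * LinBoltz.sqNorm s
        (fun v => f v - LinBoltz.mass f * LinBoltz.maxwellian v) ≤ LinBoltz.dirichlet γ b f :=
    fun s hs f hf => (mul_le_mul' le_rfl (LinBoltz.sqNorm_mono hs _)).trans (hcoer f hf)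
  refine ⟨fun ε hε => ⟨C, hC, hmono _ (by linarith)⟩, fun hpos => ⟨C, hC, hmono 0 hpos.le, ?_⟩⟩
  refine LinBoltz.hasSpectralGap_of_poincare hd hb (fun x hx hx1 => ?_) hC (hmono 0 hpos.le)
  exact le_trans (mul_nonneg hc.le (Real.rpow_nonneg (by linarith) _)) (hbc x hx hx1)
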